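/- Let $f_1,f_2,\dots$ be i.i.d. copies of a (jointly measurable) second-order stochastic process $f$ on $[0,1]$ with paths in a set $\mathcal F\subseteq L^2([0,1])$ of functions and $\mathbb E\|f\|^4<\infty$, where $\langle\cdot,\cdot\rangle$ and $\|\cdot\|$ are the $L^2([0,1])$ inner product and norm. Let $K(s,t)=\mathbb E[(f(s)-\mathbb Ef(s))(f(t)-\mathbb Ef(t))]$ be the covariance kernel, with eigenvalues $\lambda_1\ge\lambda_2\ge\cdots$ and orthonormal eigenfunctions $\phi_1,\phi_2,\dots$ (a complete list), and let $\hat K_n(s,t)=\frac1n\sum_{i=1}^n(f_i(s)-\bar f_n(s))(f_i(t)-\bar f_n(t))$, $\bar f_n=\frac1n\sum_{i=1}^n f_i$, be the empirical covariance kernel, with eigenvalues $\hat\lambda_{1,n}\ge\dots\ge\hat\lambda_{n,n}\ge0$ and orthonormal eigenfunctions $\hat\phi_{1,n},\dots,\hat\phi_{n,n}$ (a complete list of the non-zero part of the spectrum; any choice of these is allowed). Assume: 1. there are $\beta>1$ and $C_0,C_1,C_2>0$ with $C_2p^{-\beta}\le\lambda_p\le C_1p^{-\beta}$ and $\lambda_p-\lambda_{p+1}\ge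 C_0p^{-(\beta+1)}$ for all $p\ge1$ (in particular all eigenvalues are positive and simple); 2. $(a_p)$ and $(b_p)$ are real sequences and $\alpha>0$ is such that $\sum_pb_p^2<\infty$ and $|a_p|\le b_p\,p^{-\alpha}$ for all sufficiently large $p$; 3. the thresholds $\delta_n$ satisfy $\delta_n\to0$ and, for some $c>0$ and all large $n$, $\delta_n\ge c\,(\sqrt n/\log n)^{-\beta/(2\beta+1)}$. For $g\in L^2([0,1])$ put $$\|g\|_{mod}^2=\sum_{p\ge1}\frac{\langle g,\phi_p\rangle^2}{\lambda_p}a_p^2,\qquad \|g\|_b^2=\sum_{p\ge1}\frac{\langle g,\phi_p\rangle^2}{\lambda_p}b_p^2,\qquad \|g\|_{\widehat{mod}}^2=\sum_{p=1}^{C_n}\frac{\langle g,\hat\phi_{p,n}\rangle^2}{\hat\lambda_{p,n}}a_p^2$$ (values in $[0,\infty]$), where $C_n=\min(M_n,n)$ and $M_n=\max\{m:\lambda_m\ge\delta_n\}$ ($M_n=0$ if there is no such $m$). Let $$S_n=\sup\bigl\{\,\bigl|\|g\|_{\widehat{mod}}^2-\|g\|_{mod}^2\bigr| : g\in\mathcal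 F,\ \|g\|\le1,\ \|g\|_b\le1\,\bigr\}.$$ (i) If moreover $\delta_n=O(n^{-\eta})$ for some $\eta>0$, then there are constants $C,\kappa>0$ such that, with probability tending to one as $n\to\infty$, $S_n\le C\,n^{-\kappa}$. (ii) Without this extra condition, $S_n\to0$ in probability. (iii) For $f_{obs}\in\mathcal F$ let $d_{mod}(f_{obs})=\mathbb P[\|f\|_{mod}\ge\|f_{obs}\|_{mod}]$ and $d_{mod,n}(f_{obs})=\mathbb P[\|f\|_{mod}\ge\|f_{obs}\|_{\widehat{mod}}]$, where in the latter the probability is over $f$ only, the sample $f_1,\dots,f_n$ being held fixed. Then $d_{mod,n}(f_{obs})\to d_{mod}(f_{obs})$ in probability for every $f_{obs}\in\mathcal F$ such that $\mathbb P[\|f\|_{mod}=\|f_{obs}\|_{mod}]=0$; in particular for every $f_{obs}\in\mathcal F$ if $\|f\|_{mod}^2$ is almost surely finite with continuous distribution function. -/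

import Mathlib

open MeasureTheory ProbabilityTheory Filter Topology
open scoped ENNReal unitInterval

noncomputable section

/-- The `L²([0,1])` inner product of two real functions on `[0,1]`. -/
def innerL2 (f g : I → ℝ) : ℝ := ∫ t, f t * g t

/-- An i.i.d. sequence of second-order stochastic processes on `[0,1]` (jointly measurable, so that
path integrals are random variables), with sample paths in a set `F` of functions.
Independence and equality in law refer to the product σ-algebra, i.e. to the finite-dimensional
distributions. -/
structure IsIIDSecondOrder {Ω : Type*} [MeasurableSpace Ω] (P : Measure Ω)
    (F : Set (I → ℝ)) (X : ℕ → Ω → I → ℝ) : Prop where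
  measurable : ∀ i, Measurable (Function.uncurry (X i))
  path_mem : ∀ i ω, X i ω ∈ F
  indep : iIndepFun X P
  ident : ∀ i, IdentDistrib (X i) (X 0) P P
  second_order : ∀ t, MemLp (fun ω => X 0 ω t) 2 P

/-- The covariance kernel `K(s,t) = E[(f(s) - E f(s)) (f(t) - E f(t))]` of a process `f`. -/
def covKernel {Ω : Type*} [MeasurableSpace Ω] (P : Measure Ω) (f : Ω → I → ℝ) (s t : I) : ℝ :=
  cov[fun ω => f ω s, fun ω => f ω t; P]

/-- The sample mean of the first `n` functions `x 0, …, x (n-1)`. -/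
def sampleMean (x : ℕ → I → ℝ) (n : ℕ) (t : I) : ℝ :=
  (1 / (n : ℝ)) * ∑ i ∈ Finset.range n, x i t

/-- The empirical covariance kernel of the first `n` functions `x 0, …, x (n-1)`. -/
def empKernel (x : ℕ → I → ℝ) (n : ℕ) (s t : I) : ℝ :=
  (1 / (n : ℝ)) * ∑ i ∈ Finset.range n,
    (x i s - sampleMean x n s) * (x i t - sampleMean x n t)

/-- `(lam p, phi p)`, `p ∈ ι`, is an eigensystem of the integral operator on `L²([0,1])` with
kernel `K`: the `phi p` are orthonormal eigenfunctions, the eigenvalues `lam p` are non-negative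
and listed in non-increasing order, and the list is complete: the operator vanishes on the
orthogonal complement of the `phi p`. -/
structure IsEigensystem {ι : Type*} [Preorder ι] (K : I → I → ℝ) (lam : ι → ℝ)
    (phi : ι → I → ℝ) : Prop where
  memLp : ∀ p, MemLp (phi p) 2 volume
  norm_one : ∀ p, innerL2 (phi p) (phi p) = 1
  orthogonal : ∀ p q, p ≠ q → innerL2 (phi p) (phi q) = 0
  nonneg : ∀ p, 0 ≤ lam p
  antitone : Antitone lam
  eigen : ∀ p, ∀ᵐ t : I, ∫ s, K s t * phi p s = lam p * phi p t
  complete : ∀ g : I → ℝ, MemLp g 2 volume → (∀ p, innerL2 g (phi p) = 0) →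
    ∀ᵐ t : I, ∫ s, K s t * g s = 0

/-- The weighted squared norm `∑_p ⟨f, phi_p⟩² w_p² / lam_p`, with values in `[0,∞]`. -/
def weightedNormSq {ι : Type*} (lam : ι → ℝ) (phi : ι → I → ℝ) (w : ι → ℝ) (f : I → ℝ) : ℝ≥0∞ :=
  ∑' p, ENNReal.ofReal (innerL2 f (phi p) ^ 2 * w p ^ 2) / ENNReal.ofReal (lam p)

/-- `M = max {m ≥ 1 : λ_m ≥ δ}` (and `0` if there is no such `m`); the entry `lam p` of the
zero-based sequence is `λ_{p+1}`. -/
def truncLevel (lam : ℕ → ℝ) (δ : ℝ) : ℕ := sSup ((fun p => p + 1) '' {p : ℕ | δ ≤ lam p})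

/-- The sample version `∑_{p=1}^{min M n} ⟨f, phihat_p⟩² a_p² / lamhat_p` of the squared modified
norm. -/
def sampleNormSq {n : ℕ} (M : ℕ) (lamhat : Fin n → ℝ) (phihat : Fin n → I → ℝ) (a : ℕ → ℝ)
    (f : I → ℝ) : ℝ≥0∞ :=
  weightedNormSq (fun p : Fin (min M n) => lamhat (p.castLE (min_le_right M n)))
    (fun p : Fin (min M n) => phihat (p.castLE (min_le_right M n))) (fun p => a p) f

/-- The probability that the squared norm `N f` of the random function `f` is at least `r`. The
depth of a function with squared norm `r` is this number. -/
def upperTail {Ω : Type*} [MeasurableSpace Ω] (P : Measure Ω) (f : Ω → I → ℝ)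
    (N : (I → ℝ) → ℝ≥0∞) (r : ℝ≥0∞) : ℝ :=
  P.real {ω | r ≤ N (f ω)}

/-- `sup |Nhat f - N f|` over all `f ∈ F` with `‖f‖_{L²} ≤ 1` and `‖f‖_b² ≤ 1`, with values in
`[0,∞]`. The subtraction of `[0,∞]` is truncated at `0`, so that the larger of the two differences
is the absolute value; it is `∞` if exactly one of the two terms is. -/
def supError (F : Set (I → ℝ)) (bSq Nhat N : (I → ℝ) → ℝ≥0∞) : ℝ≥0∞ :=
  ⨆ f ∈ {f ∈ F | eLpNorm f 2 volume ≤ 1 ∧ bSq f ≤ 1}, max (Nhat f - N f) (N f - Nhat f)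

end

/-! All randomness is confined to one event. Put κ = β / (8(2β+1)) (`rateExponent`). By
Chebyshev-type bounds and the fourth moment, the empirical kernel is within n^(κ-1/2) of K in
L²([0,1]²) with probability tending to one (`tendsto_measure_empKernel`). On this event the
comparison is deterministic and valid for every choice of the empirical eigensystem, so that choice
need not be measurable in ω.

Let D bound the L² distance of the kernels, hence the operator distance. Weyl's inequality
(`IsDiagonal.abs_eigenvalue_sub_le`) moves each eigenvalue by at most D, and the gap of order
p^(-(β+1)) moves the eigenfunction, up to sign, by O(D p^(β+1)) (`IsDiagonal.abs_inner_sq_sub_le`).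
Dividing by the eigenvalue costs a further p^(β/2), because AM-GM absorbs the other half of the
division: for p ≤ M the p-th terms of the two norms differ by O(x) (a_p² + ⟨g,φ_p⟩² a_p² / λ_p),
where x = D M^(3β/2+1) (`abs_sample_term_sub_le`). Both summands have controlled sums: ∑ a_p² and
the modified norm of g. The lower bound on δ_n forces M_n = O(n^(1/(2(2β+1)))), which makes x =
O(n^(-κ)).

The terms beyond M_n have no empirical counterpart. On the unit ball of the b-norm their sum is at
most (M_n+1)^(-2α) ≤ (δ_n/C₂)^(2α/β) (`tsum_tail_le`, `rpow_truncLevel_le`). Head and tail together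
give (i) and (ii) (`eventually_supError_le`).

For (iii) the observed function is fixed and need not lie in any ball. If its modified norm is
finite, the tail is that of a convergent series; if it is infinite, cutting the weights off after
finitely many terms shows that the sample norm diverges too (`eventually_sampleNormSq_mem`). The
upper tail probability is continuous at every non-atom (`tendsto_upperTail`). -/

/-! ### Spectral perturbation of diagonal operators. -/

section Perturbation

variable {H : Type*} [NormedAddCommGroup H] [InnerProductSpace ℝ H]

/-- The bounded operator `T` has the orthonormal eigenvectors `φ p` with eigenvalues `l p`, and
vanishes on their orthogonal complement. -/
structure IsDiagonal {ι : Type*} (T : H →L[ℝ] H) (φ : ι → H) (l : ι → ℝ) : Prop where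
  orthonormal : Orthonormal ℝ φ
  eigen : ∀ p, T (φ p) = l p • φ p
  ker : ∀ g, (∀ p, inner ℝ (φ p) g = 0) → T g = 0

namespace IsDiagonal

variable {ι : Type*} {T : H →L[ℝ] H} {φ : ι → H} {l : ι → ℝ}

/-- The coefficients of `T v` in a Hilbert basis extending the eigenvectors. -/
theorem exists_hilbertBasis [CompleteSpace H] (h : IsDiagonal T φ l) :
    ∃ (s : Set H) (b : HilbertBasis s ℝ H) (m : s → ℝ),
      (∀ i v, inner ℝ (b i) (T v) = m i * inner ℝ (b i) v) ∧
      ∀ i, (∃ p, b i = φ p ∧ m i = l p) ∨ m i = 0 := by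
  obtain ⟨s, b, hs, hb⟩ := (Orthonormal.toSubtypeRange h.orthonormal).exists_hilbertBasis_extension
  -- The vectors added to complete the basis are orthogonal to every eigenvector, so `T` kills them:
  -- they get the multiplier 0.
  have hcases : ∀ i : s, (∃ p, b i = φ p) ∨ ∀ p, inner ℝ (φ p) (b i) = 0 := by
    intro i
    by_cases hi : ∃ p, b i = φ p
    · exact Or.inl hi
    · right
      intro p
      have hp : φ p ∈ s := hs ⟨p, rfl⟩
      have h1 : b ⟨φ p, hp⟩ = φ p := by rw [hb]
      rw [← h1]
      apply b.orthonormal.2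
      intro h2
      exact hi ⟨p, by rw [← h2, h1]⟩
  have hm : ∀ i : s, ∃ m : ℝ, T (b i) = m • b i ∧ ((∃ p, b i = φ p ∧ m = l p) ∨ m = 0) := by
    intro i
    rcases hcases i with ⟨p, hp⟩ | h0
    · exact ⟨l p, by rw [hp, h.eigen], Or.inl ⟨p, hp, rfl⟩⟩
    · exact ⟨0, by rw [h.ker _ h0, zero_smul], Or.inr rfl⟩
  choose m hm1 hm2 using hm
  refine ⟨s, b, m, ?_, hm2⟩
  intro i v
  have h1 := ((b.hasSum_repr v).mapL T).mapL (innerSL ℝ (b i))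
  have h2 : HasSum (fun j => (innerSL ℝ (b i)) (T (b.repr v j • b j)))
      (m i * inner ℝ (b i) v) := by
    have : m i * inner ℝ (b i) v = (innerSL ℝ (b i)) (T (b.repr v i • b i)) := by
      simp [hm1, b.repr_apply_apply, b.orthonormal.1 i]
      ring
    rw [this]
    apply hasSum_single
    intro j hj
    have := b.orthonormal.2 hj.symm
    simp [hm1, this]
  exact h1.unique h2

/-- Parseval in the diagonalising basis. The hypothesis `0 ≤ m` covers the basis vectors on which
`T` vanishes. -/
theorem inner_apply_le [CompleteSpace H] (h : IsDiagonal T φ l) {m : ℝ} (hm : 0 ≤ m) {v : H}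
    (hv : ∀ p, l p ≤ m ∨ inner ℝ (φ p) v = 0) : inner ℝ v (T v) ≤ m * ‖v‖ ^ 2 := by
  obtain ⟨s, b, μ, h1, h2⟩ := h.exists_hilbertBasis
  have e1 := b.hasSum_inner_mul_inner v (T v)
  have e2 := (b.hasSum_inner_mul_inner v v).mul_left m
  rw [real_inner_self_eq_norm_sq] at e2
  refine hasSum_le (fun i => ?_) e1 e2
  rw [h1, real_inner_comm v (b i)]
  have hsq := mul_self_nonneg (inner ℝ v (b i))
  rcases h2 i with ⟨p, hp, hl⟩ | h0
  · rcases hv p with hle | hz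
    · rw [hl]; nlinarith
    · rw [← hp, real_inner_comm] at hz
      simp [hz]
  · rw [h0]; nlinarith

/-- Again Parseval: `T - m` multiplies each coordinate that `v` really has by at least `γ` in
absolute value. On the added basis vectors the multiplier is `-m`, whence `γ ≤ |m|`. -/
theorem mul_norm_le [CompleteSpace H] (h : IsDiagonal T φ l) {m γ : ℝ} (hγ : 0 ≤ γ)
    (hm : γ ≤ |m|) {v : H} (hv : ∀ p, γ ≤ |l p - m| ∨ inner ℝ (φ p) v = 0) :
    γ * ‖v‖ ≤ ‖T v - m • v‖ := by
  obtain ⟨s, b, μ, h1, h2⟩ := h.exists_hilbertBasis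
  have e1 := b.hasSum_inner_mul_inner (T v - m • v) (T v - m • v)
  have e2 := (b.hasSum_inner_mul_inner v v).mul_left (γ ^ 2)
  rw [real_inner_self_eq_norm_sq] at e1 e2
  have key : γ ^ 2 * ‖v‖ ^ 2 ≤ ‖T v - m • v‖ ^ 2 := by
    refine hasSum_le (fun i => ?_) e2 e1
    rw [real_inner_comm (b i) (T v - m • v), inner_sub_right, h1, inner_smul_right,
      real_inner_comm (b i) v]
    have hsq := mul_self_nonneg (inner ℝ (b i) v)
    have hx : ∀ x : ℝ, γ ≤ |x| → γ ^ 2 ≤ x ^ 2 := fun x hx => by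
      rw [← sq_abs x]; gcongr
    rcases h2 i with ⟨p, hp, hl⟩ | h0
    · rcases hv p with hle | hz
      · rw [hl]; nlinarith [hx _ hle]
      · rw [← hp] at hz
        simp [hz]
    · rw [h0]; nlinarith [hx _ hm]
  rw [← mul_pow] at key
  exact le_of_sq_le_sq key (norm_nonneg _)

theorem le_inner_apply (h : IsDiagonal T φ l) {κ : Type*} [Fintype κ] {s : κ → ι}
    (hs : Function.Injective s) {m : ℝ} (hm : ∀ i, m ≤ l (s i)) (c : κ → ℝ) :
    m * ‖∑ i, c i • φ (s i)‖ ^ 2 ≤ inner ℝ (∑ i, c i • φ (s i)) (T (∑ i, c i • φ (s i))) := by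
  have ho : Orthonormal ℝ (fun i => φ (s i)) := h.orthonormal.comp s hs
  have e : T (∑ i, c i • φ (s i)) = ∑ i, (c i * l (s i)) • φ (s i) := by
    simp [map_sum, h.eigen, smul_smul]
  rw [e, ← real_inner_self_eq_norm_sq, ho.inner_sum, ho.inner_sum, Finset.mul_sum]
  refine Finset.sum_le_sum fun i _ => ?_
  simp only [conj_trivial]
  nlinarith [hm i, mul_self_nonneg (c i)]

/-- One half of Weyl's inequality. -/
theorem le_add_norm_sub [CompleteSpace H] (h : IsDiagonal T φ l) {ι' : Type*} {T' : H →L[ℝ] H}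
    {φ' : ι' → H} {l' : ι' → ℝ} (h' : IsDiagonal T' φ' l') {k : ℕ} {s : Fin (k + 1) → ι}
    (hs : Function.Injective s) {m m' : ℝ} (hm : ∀ i, m ≤ l (s i)) (t : Fin k → ι')
    (hm' : ∀ q, q ∉ Set.range t → l' q ≤ m') (hm'0 : 0 ≤ m') : m ≤ m' + ‖T - T'‖ := by
  let f : (Fin (k + 1) → ℝ) →ₗ[ℝ] (Fin k → ℝ) :=
    LinearMap.pi fun j => ∑ i, (inner ℝ (φ' (t j)) (φ (s i))) • LinearMap.proj i
  -- There are `k` linear conditions on `k + 1` coefficients, so some nonzero `v` in the span of the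
  -- `φ (s i)` is orthogonal to all the `φ' (t j)`. The two quadratic forms are compared at this
  -- `v`.
  have hf : LinearMap.ker f ≠ ⊥ := LinearMap.ker_ne_bot_of_finrank_lt (by simp)
  obtain ⟨c, hc, hc0⟩ := Submodule.exists_mem_ne_zero_of_ne_bot hf
  set v := ∑ i, c i • φ (s i) with hv
  have hvt : ∀ j, inner ℝ (φ' (t j)) v = 0 := by
    intro j
    have := congrFun (LinearMap.mem_ker.1 hc) j
    simp only [f, LinearMap.pi_apply, LinearMap.sum_apply, LinearMap.smul_apply,
      LinearMap.proj_apply, smul_eq_mul, Pi.zero_apply] at this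
    rw [hv, inner_sum, ← this]
    refine Finset.sum_congr rfl fun i _ => ?_
    rw [inner_smul_right, mul_comm]
  have hv0 : v ≠ 0 := by
    intro h0
    apply hc0
    have := (Fintype.linearIndependent_iff.1 (h.orthonormal.comp s hs).linearIndependent) c h0
    exact funext this
  have h1 : m * ‖v‖ ^ 2 ≤ inner ℝ v (T v) := h.le_inner_apply hs hm c
  have h2 : inner ℝ v (T' v) ≤ m' * ‖v‖ ^ 2 := by
    refine h'.inner_apply_le hm'0 fun q => ?_
    by_cases hq : q ∈ Set.range t
    · obtain ⟨j, rfl⟩ := hq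
      exact Or.inr (hvt j)
    · exact Or.inl (hm' q hq)
  have h3 : inner ℝ v ((T - T') v) ≤ ‖T - T'‖ * ‖v‖ ^ 2 := by
    calc inner ℝ v ((T - T') v) ≤ ‖v‖ * ‖(T - T') v‖ := real_inner_le_norm _ _
      _ ≤ ‖v‖ * (‖T - T'‖ * ‖v‖) := by gcongr; exact (T - T').le_opNorm v
      _ = _ := by ring
  rw [sub_apply, inner_sub_right] at h3
  have hpos : 0 < ‖v‖ ^ 2 := by positivity
  by_contra! hlt
  nlinarith

/-- Weyl's inequality for the eigenvalues of two operators, one of which has finite rank. -/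
theorem abs_eigenvalue_sub_le [CompleteSpace H] {φ : ℕ → H} {l : ℕ → ℝ} (h : IsDiagonal T φ l)
    (hl : Antitone l) (hl0 : ∀ p, 0 ≤ l p) {n : ℕ} {T' : H →L[ℝ] H} {φ' : Fin n → H}
    {l' : Fin n → ℝ} (h' : IsDiagonal T' φ' l') (hl' : Antitone l') (hl'0 : ∀ p, 0 ≤ l' p)
    (p : Fin n) : |l' p - l p| ≤ ‖T' - T‖ := by
  have hinj : Function.Injective (Fin.castLE (p.2 : (p : ℕ) + 1 ≤ n)) := Fin.castLE_injective _
  rw [abs_sub_le_iff]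
  constructor
  · rw [sub_le_iff_le_add']
    refine h'.le_add_norm_sub h hinj (fun i => hl' ?_) (fun i : Fin p => (i : ℕ)) ?_ (hl0 p)
    · rw [Fin.le_def]; exact Nat.lt_succ_iff.1 i.2
    · intro q hq
      apply hl
      by_contra! hlt
      exact hq ⟨⟨q, hlt⟩, rfl⟩
  · rw [sub_le_iff_le_add', norm_sub_rev]
    refine h.le_add_norm_sub h' (s := fun i : Fin ((p : ℕ) + 1) => (i : ℕ)) Fin.val_injective
      (fun i => hl ?_) (Fin.castLE p.2.le) ?_ (hl'0 p)
    · exact Nat.lt_succ_iff.1 i.2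
    · intro q hq
      apply hl'
      by_contra! hlt
      exact hq ⟨⟨q, hlt⟩, rfl⟩

end IsDiagonal

/-- With c = ⟨u, v⟩ and s its sign, the two squared norms are 2 - 2|c| and 1 - c², and |c| ≤ 1. -/
theorem exists_sign_norm_sub_le {u v : H} (hu : ‖u‖ = 1) (hv : ‖v‖ = 1) :
    ∃ s : ℝ, s ^ 2 = 1 ∧ ‖v - s • u‖ ^ 2 ≤ 2 * ‖v - inner ℝ u v • u‖ ^ 2 := by
  have e : ∀ s : ℝ, ‖v - s • u‖ ^ 2 = 1 - 2 * s * inner ℝ u v + s ^ 2 := by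
    intro s
    rw [norm_sub_sq_real, inner_smul_right, norm_smul, hu, hv, real_inner_comm]
    simp; ring
  have hle : |inner ℝ u v| ≤ 1 := by
    simpa [hu, hv] using abs_real_inner_le_norm u v
  rw [abs_le] at hle
  rcases le_total 0 (inner ℝ u v : ℝ) with h | h
  · refine ⟨1, by norm_num, ?_⟩
    rw [e, e]; nlinarith
  · refine ⟨-1, by norm_num, ?_⟩
    rw [e, e]; nlinarith

/-- Eigenvectors are determined only up to sign, which squared coefficients do not see; the rest is
a factored difference of squares. -/
theorem abs_inner_sq_sub_le {u v g : H} {s ρ : ℝ} (hs : s ^ 2 = 1) (hρ : ‖v - s • u‖ ≤ ρ) :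
    |inner ℝ g v ^ 2 - inner ℝ g u ^ 2| ≤ ρ * ‖g‖ * (2 * |inner ℝ g u| + ρ * ‖g‖) := by
  have hs1 : |s| = 1 := by
    rw [← sq_abs] at hs
    nlinarith [abs_nonneg s]
  set d : ℝ := inner ℝ g (v - s • u) with hd
  have hdle : |d| ≤ ρ * ‖g‖ := by
    calc |d| ≤ ‖g‖ * ‖v - s • u‖ := abs_real_inner_le_norm _ _
      _ ≤ ‖g‖ * ρ := by gcongr
      _ = _ := mul_comm _ _
  have e : (inner ℝ g v : ℝ) = d + s * inner ℝ g u := by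
    rw [hd, inner_sub_right, inner_smul_right]; ring
  have e2 : (inner ℝ g v : ℝ) ^ 2 - inner ℝ g u ^ 2 = d * (2 * (s * inner ℝ g u) + d) := by
    rw [e]; linear_combination (inner ℝ g u : ℝ) ^ 2 * hs
  rw [e2, abs_mul]
  gcongr
  · exact (abs_nonneg d).trans hdle
  · calc _ ≤ |2 * (s * inner ℝ g u)| + |d| := abs_add_le _ _
      _ = 2 * |inner ℝ g u| + |d| := by rw [abs_mul, abs_mul, hs1]; simp
      _ ≤ _ := by gcongr

/-- Perturbation of a simple eigenvector with spectral gap `γ`. -/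
theorem IsDiagonal.abs_inner_sq_sub_le [CompleteSpace H] {T T' : H →L[ℝ] H} {φ : ℕ → H}
    {l : ℕ → ℝ} (h : IsDiagonal T φ l) {p : ℕ} {γ D m' : ℝ} (hγ : 0 < γ) (hγl : γ ≤ |l p|)
    (hgap : ∀ q, q ≠ p → γ ≤ |l q - l p|) {v : H} (hv : ‖v‖ = 1) (hTv : T' v = m' • v)
    (hm' : |m' - l p| ≤ D) (hD : ‖T' - T‖ ≤ D) (g : H) :
    |inner ℝ g v ^ 2 - inner ℝ g (φ p) ^ 2| ≤
      3 * D / γ * ‖g‖ * (2 * |inner ℝ g (φ p)| + 3 * D / γ * ‖g‖) := by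
  have hu : ‖φ p‖ = 1 := h.orthonormal.1 p
  obtain ⟨s, hs, hle⟩ := exists_sign_norm_sub_le hu hv
  refine _root_.abs_inner_sq_sub_le hs ?_
  set w := v - (inner ℝ (φ p) v : ℝ) • φ p with hw
  have h1 : γ * ‖w‖ ≤ ‖T w - l p • w‖ := by
    refine h.mul_norm_le hγ.le hγl fun q => ?_
    by_cases hq : q = p
    · right
      rw [hq, hw, inner_sub_right, inner_smul_right, real_inner_self_eq_norm_sq, hu]; simp
    · exact Or.inl (hgap q hq)
  -- `T - l p` annihilates `φ p`, so only `v` contributes; there `T'` acts as `m'`, leaving two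
  -- errors of size at most `D`.
  have h2 : T w - l p • w = (m' - l p) • v - (T' - T) v := by
    rw [hw, map_sub, map_smul, h.eigen, sub_apply, hTv]
    module
  have h3 : ‖T w - l p • w‖ ≤ 2 * D := by
    rw [h2]
    calc _ ≤ ‖(m' - l p) • v‖ + ‖(T' - T) v‖ := norm_sub_le _ _
      _ ≤ |m' - l p| + ‖T' - T‖ := by
        gcongr
        · rw [norm_smul, hv, mul_one, Real.norm_eq_abs]
        · simpa [hv] using (T' - T).le_opNorm v
      _ ≤ _ := by linarith
  have hD0 : 0 ≤ D := (norm_nonneg _).trans hD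
  have h4 : ‖w‖ ≤ 2 * D / γ := by
    rw [le_div_iff₀ hγ]; linarith
  -- The constant 3 comes from 2 · 2² = 8 ≤ 3².
  have h5 : ‖v - s • φ p‖ ^ 2 ≤ (3 * D / γ) ^ 2 := by
    calc _ ≤ 2 * ‖w‖ ^ 2 := hle
      _ ≤ 2 * (2 * D / γ) ^ 2 := by gcongr
      _ ≤ _ := by
        rw [div_pow, div_pow, mul_div_assoc']
        gcongr
        nlinarith [sq_nonneg D]
  exact le_of_sq_le_sq h5 (by positivity)

end Perturbation

/-! ### Integral operators with square integrable kernels. -/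

section IntegralOperator

variable {α : Type*} [MeasurableSpace α] {μ : Measure α}

theorem enorm_integral_mul_sq_le {f g : α → ℝ} (hf : AEMeasurable f μ) (hg : AEMeasurable g μ) :
    ‖∫ s, f s * g s ∂μ‖ₑ ^ 2 ≤ (∫⁻ s, ‖f s‖ₑ ^ 2 ∂μ) * ∫⁻ s, ‖g s‖ₑ ^ 2 ∂μ := by
  have h1 : ‖∫ s, f s * g s ∂μ‖ₑ ≤ ∫⁻ s, ‖f s‖ₑ * ‖g s‖ₑ ∂μ := by
    refine (enorm_integral_le_lintegral_enorm _).trans_eq ?_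
    simp only [enorm_mul]
  have h2 := ENNReal.lintegral_mul_le_Lp_mul_Lq μ Real.HolderConjugate.two_two hf.enorm hg.enorm
  have h3 := h1.trans h2
  calc ‖∫ s, f s * g s ∂μ‖ₑ ^ 2 ≤ _ := pow_le_pow_left' h3 2
    _ = _ := by
      rw [mul_pow, ← ENNReal.rpow_natCast, ← ENNReal.rpow_natCast, ← ENNReal.rpow_mul,
        ← ENNReal.rpow_mul]
      norm_num

theorem eLpNorm_two_sq {β : Type*} [MeasurableSpace β] (ν : Measure β) (f : β → ℝ) :
    eLpNorm f 2 ν ^ 2 = ∫⁻ s, ‖f s‖ₑ ^ 2 ∂ν := by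
  have := eLpNorm_nnreal_pow_eq_lintegral (f := f) (μ := ν) (p := 2) (by norm_num)
  simpa using this

variable [SFinite μ] {k : α → α → ℝ}

theorem ae_memLp_slice (hk : MemLp (Function.uncurry k) 2 (μ.prod μ)) :
    ∀ᵐ t ∂μ, MemLp (fun s => k s t) 2 μ := by
  filter_upwards [hk.integrable_sq.prod_left_ae, hk.1.prodMk_right] with t h1 h2
  exact (memLp_two_iff_integrable_sq h2).2 h1

theorem aestronglyMeasurable_integral_mul (hk : MemLp (Function.uncurry k) 2 (μ.prod μ))
    {g : α → ℝ} (hg : MemLp g 2 μ) :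
    AEStronglyMeasurable (fun t => ∫ s, k s t * g s ∂μ) μ := by
  have : AEStronglyMeasurable (fun z : α × α => k z.2 z.1 * g z.2) (μ.prod μ) :=
    hk.1.prod_swap.mul hg.1.comp_snd
  exact this.integral_prod_right'

/-- Cauchy–Schwarz in `s` for almost every `t`, then integration in `t`: the Hilbert–Schmidt norm
dominates the operator norm. -/
theorem eLpNorm_integral_mul_le (hk : MemLp (Function.uncurry k) 2 (μ.prod μ))
    {g : α → ℝ} (hg : MemLp g 2 μ) :
    eLpNorm (fun t => ∫ s, k s t * g s ∂μ) 2 μ ≤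
      eLpNorm (Function.uncurry k) 2 (μ.prod μ) * eLpNorm g 2 μ := by
  rw [← ENNReal.pow_le_pow_left_iff (n := 2) (by norm_num), mul_pow, eLpNorm_two_sq, eLpNorm_two_sq,
    eLpNorm_two_sq]
  calc ∫⁻ t, ‖∫ s, k s t * g s ∂μ‖ₑ ^ 2 ∂μ
      ≤ ∫⁻ t, (∫⁻ s, ‖k s t‖ₑ ^ 2 ∂μ) * ∫⁻ s, ‖g s‖ₑ ^ 2 ∂μ ∂μ := by
        refine lintegral_mono_ae ?_
        filter_upwards [ae_memLp_slice hk] with t ht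
        exact enorm_integral_mul_sq_le ht.1.aemeasurable hg.1.aemeasurable
    _ = _ := by
        rw [lintegral_mul_const'']
        · rw [lintegral_prod_symm _ (hk.1.enorm.pow_const 2)]
          rfl
        · exact (hk.1.enorm.pow_const 2).lintegral_prod_left'

theorem memLp_integral_mul (hk : MemLp (Function.uncurry k) 2 (μ.prod μ))
    {g : α → ℝ} (hg : MemLp g 2 μ) : MemLp (fun t => ∫ s, k s t * g s ∂μ) 2 μ :=
  ⟨aestronglyMeasurable_integral_mul hk hg,
    (eLpNorm_integral_mul_le hk hg).trans_lt (ENNReal.mul_lt_top hk.2 hg.2)⟩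

theorem ae_integrable_mul (hk : MemLp (Function.uncurry k) 2 (μ.prod μ))
    {g : α → ℝ} (hg : MemLp g 2 μ) : ∀ᵐ t ∂μ, Integrable (fun s => k s t * g s) μ := by
  filter_upwards [ae_memLp_slice hk] with t ht
  exact ht.integrable_mul hg

/-- The Hilbert–Schmidt integral operator with a square integrable kernel. -/
theorem exists_integralOperator (hk : MemLp (Function.uncurry k) 2 (μ.prod μ)) :
    ∃ T : Lp ℝ 2 μ →L[ℝ] Lp ℝ 2 μ,
      ∀ g : Lp ℝ 2 μ, T g =ᵐ[μ] fun t => ∫ s, k s t * g s ∂μ := by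
  let T : Lp ℝ 2 μ →ₗ[ℝ] Lp ℝ 2 μ :=
    { toFun := fun g => (memLp_integral_mul hk (Lp.memLp g)).toLp
      map_add' := by
        intro g h
        ext1
        filter_upwards [MemLp.coeFn_toLp (memLp_integral_mul hk (Lp.memLp (g + h))),
          MemLp.coeFn_toLp (memLp_integral_mul hk (Lp.memLp g)),
          MemLp.coeFn_toLp (memLp_integral_mul hk (Lp.memLp h)),
          Lp.coeFn_add (memLp_integral_mul hk (Lp.memLp g)).toLp
            (memLp_integral_mul hk (Lp.memLp h)).toLp,
          ae_integrable_mul hk (Lp.memLp g), ae_integrable_mul hk (Lp.memLp h)]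
          with t h1 h2 h3 h4 h5 h6
        rw [h4, Pi.add_apply, h1, h2, h3, ← integral_add h5 h6]
        refine integral_congr_ae ?_
        filter_upwards [Lp.coeFn_add g h] with s hs
        rw [hs, Pi.add_apply, mul_add]
      map_smul' := by
        intro c g
        ext1
        filter_upwards [MemLp.coeFn_toLp (memLp_integral_mul hk (Lp.memLp (c • g))),
          MemLp.coeFn_toLp (memLp_integral_mul hk (Lp.memLp g)),
          Lp.coeFn_smul c (memLp_integral_mul hk (Lp.memLp g)).toLp] with t h1 h2 h4
        rw [RingHom.id_apply, h4, Pi.smul_apply, h1, h2, smul_eq_mul, ← integral_const_mul]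
        refine integral_congr_ae ?_
        filter_upwards [Lp.coeFn_smul c g] with s hs
        rw [hs, Pi.smul_apply, smul_eq_mul]; ring }
  refine ⟨T.mkContinuous (eLpNorm (Function.uncurry k) 2 (μ.prod μ)).toReal fun g => ?_,
    fun g => ?_⟩
  · rw [Lp.norm_def, Lp.norm_def, ← ENNReal.toReal_mul]
    refine ENNReal.toReal_mono (ENNReal.mul_lt_top hk.2 (Lp.memLp g).2).ne ?_
    exact (eLpNorm_congr_ae (MemLp.coeFn_toLp (memLp_integral_mul hk (Lp.memLp g)))).trans_le
      (eLpNorm_integral_mul_le hk (Lp.memLp g))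
  · exact MemLp.coeFn_toLp (memLp_integral_mul hk (Lp.memLp g))

theorem norm_sub_le_of_kernel {K : α → α → ℝ} (hk : MemLp (Function.uncurry k) 2 (μ.prod μ))
    (hK : MemLp (Function.uncurry K) 2 (μ.prod μ)) {T T' : Lp ℝ 2 μ →L[ℝ] Lp ℝ 2 μ}
    (hT : ∀ g : Lp ℝ 2 μ, T g =ᵐ[μ] fun t => ∫ s, k s t * g s ∂μ)
    (hT' : ∀ g : Lp ℝ 2 μ, T' g =ᵐ[μ] fun t => ∫ s, K s t * g s ∂μ) {D : ℝ} (hD : 0 ≤ D)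
    (h : eLpNorm (fun z : α × α => k z.1 z.2 - K z.1 z.2) 2 (μ.prod μ) ≤ ENNReal.ofReal D) :
    ‖T - T'‖ ≤ D := by
  refine ContinuousLinearMap.opNorm_le_bound _ hD fun g => ?_
  have hkK : MemLp (Function.uncurry fun s t => k s t - K s t) 2 (μ.prod μ) := hk.sub hK
  have e : (T - T') g =ᵐ[μ] fun t => ∫ s, (k s t - K s t) * g s ∂μ := by
    filter_upwards [hT g, hT' g, Lp.coeFn_sub (T g) (T' g), ae_integrable_mul hk (Lp.memLp g),
      ae_integrable_mul hK (Lp.memLp g)] with t h1 h2 h3 h4 h5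
    rw [sub_apply, h3, Pi.sub_apply, h1, h2, ← integral_sub h4 h5]
    simp only [sub_mul]
  rw [Lp.norm_def, eLpNorm_congr_ae e, Lp.norm_def, ← ENNReal.toReal_ofReal hD,
    ← ENNReal.toReal_mul]
  refine ENNReal.toReal_mono (ENNReal.mul_lt_top ENNReal.ofReal_lt_top (Lp.memLp g).2).ne ?_
  refine (eLpNorm_integral_mul_le hkK (Lp.memLp g)).trans ?_
  gcongr
  exact h

end IntegralOperator

/-! ### From eigensystems of kernels to diagonal operators, and the error of a single term. -/

theorem inner_toLp {f g : I → ℝ} (hf : MemLp f 2 volume) (hg : MemLp g 2 volume) :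
    inner ℝ hf.toLp hg.toLp = innerL2 f g := by
  rw [L2.inner_def, innerL2]
  refine integral_congr_ae ?_
  filter_upwards [hf.coeFn_toLp, hg.coeFn_toLp] with t h1 h2
  rw [h1, h2]
  simp [mul_comm]

theorem IsEigensystem.isDiagonal {ι : Type*} [Preorder ι] {K : I → I → ℝ} {lam : ι → ℝ}
    {phi : ι → I → ℝ} (h : IsEigensystem K lam phi)
    {T : Lp ℝ 2 (volume : Measure I) →L[ℝ] Lp ℝ 2 (volume : Measure I)}
    (hT : ∀ g : Lp ℝ 2 (volume : Measure I), T g =ᵐ[volume] fun t => ∫ s, K s t * g s) :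
    IsDiagonal T (fun p => (h.memLp p).toLp) lam := by
  have hT' : ∀ (g : I → ℝ) (hg : MemLp g 2 volume),
      T hg.toLp =ᵐ[volume] fun t => ∫ s, K s t * g s := by
    intro g hg
    refine (hT _).trans (Eventually.of_forall fun t => integral_congr_ae ?_)
    filter_upwards [hg.coeFn_toLp] with s hs
    rw [hs]
  refine ⟨⟨fun p => ?_, fun p q hpq => ?_⟩, fun p => ?_, fun g hg => ?_⟩
  · have := inner_toLp (h.memLp p) (h.memLp p)
    rw [h.norm_one, real_inner_self_eq_norm_sq] at this
    nlinarith [norm_nonneg (h.memLp p).toLp]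
  · simp only [inner_toLp]
    exact h.orthogonal p q hpq
  · ext1
    filter_upwards [hT' _ (h.memLp p), h.eigen p, Lp.coeFn_smul (lam p) (h.memLp p).toLp,
      (h.memLp p).coeFn_toLp] with t h1 h2 h3 h4
    rw [h1, h2, h3, Pi.smul_apply, h4, smul_eq_mul]
  · ext1
    have hz : ∀ p, innerL2 g (phi p) = 0 := by
      intro p
      rw [← inner_toLp (Lp.memLp g) (h.memLp p), Lp.toLp_coeFn, real_inner_comm]
      exact hg p
    filter_upwards [hT g, h.complete g (Lp.memLp g) hz, Lp.coeFn_zero ℝ 2 (volume : Measure I)]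
      with t h1 h2 h3
    rw [h1, h2, h3, Pi.zero_apply]

/-- The numerator and denominator are perturbed separately, with `l' ≥ l / 2`. The form of the bound
matters: summed over p, w² and c² w² / l give the weight sum and the modified norm. -/
theorem abs_sq_mul_div_sub_le {l l' c c' w r G D : ℝ} (hl : 0 < l) (hll : |l' - l| ≤ D)
    (hDl : D ≤ l / 2) (hr : 0 ≤ r) (hG : 0 ≤ G)
    (hc : |c' ^ 2 - c ^ 2| ≤ r * G * (2 * |c| + r * G)) :
    0 < l' ∧ |c' ^ 2 * w ^ 2 / l' - c ^ 2 * w ^ 2 / l| ≤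
      2 * G * (r / √l) * (w ^ 2 + c ^ 2 * w ^ 2 / l) + 2 * G ^ 2 * (r / √l) ^ 2 * w ^ 2 +
        2 * (D / l) * (c ^ 2 * w ^ 2 / l) := by
  have h1 := (abs_le.1 hll).1
  have hl' : l / 2 ≤ l' := by linarith
  have hl'0 : 0 < l' := by linarith
  refine ⟨hl'0, ?_⟩
  have hs : 0 < √l := Real.sqrt_pos.2 hl
  have hss : √l ^ 2 = l := Real.sq_sqrt hl.le
  have e : c' ^ 2 * w ^ 2 / l' - c ^ 2 * w ^ 2 / l =
      w ^ 2 * (c' ^ 2 - c ^ 2) / l' + c ^ 2 * w ^ 2 * (l - l') / (l * l') := by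
    field_simp; ring
  rw [e]
  have a1 : |w ^ 2 * (c' ^ 2 - c ^ 2) / l'| ≤
      2 * G * (r / √l) * (w ^ 2 + c ^ 2 * w ^ 2 / l) + 2 * G ^ 2 * (r / √l) ^ 2 * w ^ 2 := by
    rw [abs_div, abs_mul, abs_of_pos hl'0, abs_of_nonneg (sq_nonneg w)]
    have b1 : w ^ 2 * |c' ^ 2 - c ^ 2| / l' ≤
        w ^ 2 * (r * G * (2 * |c| + r * G)) / (l / 2) := by gcongr
    refine b1.trans ?_
    -- AM-GM trades the cross term, linear in `c`, for these two summable quantities.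
    have b2 : 2 * (w ^ 2 * (|c| / √l)) ≤ w ^ 2 + c ^ 2 * w ^ 2 / l := by
      have : c ^ 2 * w ^ 2 / l = (w * (|c| / √l)) ^ 2 := by
        rw [mul_pow, div_pow, hss, sq_abs]; ring
      rw [this]
      have h2 : w ^ 2 * (|c| / √l) ≤ |w| * |w * (|c| / √l)| := by
        rw [abs_mul w, ← mul_assoc, abs_mul_abs_self, ← sq]
        gcongr
        exact le_abs_self _
      have h3 := two_mul_le_add_sq |w| |w * (|c| / √l)|
      rw [sq_abs, sq_abs] at h3
      linarith
    have b3 : w ^ 2 * (r * G * (2 * |c| + r * G)) / (l / 2) =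
        2 * G * (r / √l) * (2 * (w ^ 2 * (|c| / √l))) + 2 * G ^ 2 * (r / √l) ^ 2 * w ^ 2 := by
      rw [show l / 2 = √l ^ 2 / 2 by rw [hss]]; field_simp
    rw [b3]
    gcongr
  have a2 : |c ^ 2 * w ^ 2 * (l - l') / (l * l')| ≤ 2 * (D / l) * (c ^ 2 * w ^ 2 / l) := by
    rw [abs_div, abs_mul, abs_of_pos (mul_pos hl hl'0), abs_sub_comm,
      abs_of_nonneg (by positivity : 0 ≤ c ^ 2 * w ^ 2)]
    have hD : 0 ≤ D := (abs_nonneg _).trans hll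
    calc _ ≤ c ^ 2 * w ^ 2 * D / (l * (l / 2)) := by gcongr
      _ = _ := by field_simp
  exact (abs_add_le _ _).trans (add_le_add a1 a2)

/-- The constant in the bound for the error of the truncated squared norm. -/
noncomputable def headConst (C₀ C₂ G : ℝ) : ℝ :=
  2 * G * (3 / (C₀ * √C₂)) + 2 * G ^ 2 * (3 / (C₀ * √C₂)) ^ 2 + 2 * (1 / C₂)

theorem headConst_nonneg {C₀ C₂ G : ℝ} (hC₀ : 0 < C₀) (hC₂ : 0 < C₂) (hG : 0 ≤ G) :
    0 ≤ headConst C₀ C₂ G := by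
  unfold headConst; positivity

/-- For `q < p` the relevant gap is the one just before `p`; its lower bound is larger, since the
bound decreases with the index. -/
theorem gap_le_abs_sub {lam : ℕ → ℝ} (hanti : Antitone lam) {C₀ τ : ℝ} (hC₀ : 0 < C₀) (hτ : 0 ≤ τ)
    (hgap : ∀ p : ℕ, C₀ * ((p : ℝ) + 1) ^ (-τ) ≤ lam p - lam (p + 1)) {p q : ℕ} (hq : q ≠ p) :
    C₀ * ((p : ℝ) + 1) ^ (-τ) ≤ |lam q - lam p| := by
  rcases lt_or_gt_of_ne hq with h | h
  · obtain ⟨p, rfl⟩ : ∃ k, p = k + 1 := ⟨p - 1, by omega⟩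
    have h1 := hgap p
    have h2 : lam p ≤ lam q := hanti (by omega)
    have h3 : (((p + 1 : ℕ) : ℝ) + 1) ^ (-τ) ≤ ((p : ℝ) + 1) ^ (-τ) :=
      Real.rpow_le_rpow_of_nonpos (by positivity) (by push_cast; linarith) (by linarith)
    calc _ ≤ C₀ * ((p : ℝ) + 1) ^ (-τ) := by gcongr
      _ ≤ lam q - lam (p + 1) := by linarith
      _ ≤ _ := le_abs_self _
  · have h1 := hgap p
    have h2 : lam q ≤ lam (p + 1) := hanti (by omega)
    rw [abs_sub_comm]
    exact (by linarith : _ ≤ lam p - lam q).trans (le_abs_self _)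

section Truncated

variable {n : ℕ} {k K : I → I → ℝ} {lam : ℕ → ℝ} {phi : ℕ → I → ℝ} {lamhat : Fin n → ℝ}
  {phihat : Fin n → I → ℝ} {β C₀ C₂ D x : ℝ}

/-- In the exponent 3β/2 + 1, the part β + 1 is the reciprocal gap and β/2 the reciprocal root of
the eigenvalue. The bound `x ≤ C₂ / 2` keeps `D` below half the eigenvalue, and `x ≤ 1` lets
quadratic errors be absorbed into linear ones. -/
theorem abs_sample_term_sub_le (hk : MemLp (Function.uncurry k) 2 (volume.prod volume))
    (hK : MemLp (Function.uncurry K) 2 (volume.prod volume))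
    (h : IsEigensystem K lam phi) (h' : IsEigensystem k lamhat phihat)
    (hβ : 0 < β) (hC₀ : 0 < C₀) (hC₂ : 0 < C₂)
    (hlam_ge : ∀ p : ℕ, C₂ * ((p : ℝ) + 1) ^ (-β) ≤ lam p)
    (hgap : ∀ p : ℕ, C₀ * ((p : ℝ) + 1) ^ (-(β + 1)) ≤ lam p - lam (p + 1))
    (hD : 0 ≤ D)
    (hkK : eLpNorm (fun z : I × I => k z.1 z.2 - K z.1 z.2) 2 (volume.prod volume)
      ≤ ENNReal.ofReal D)
    {m : ℕ} (hx : D * (m : ℝ) ^ (3 * β / 2 + 1) ≤ x) (hx1 : x ≤ 1) (hx2 : x ≤ C₂ / 2)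
    (p : Fin n) (hp : (p : ℕ) < m) {g : I → ℝ} (hg : MemLp g 2 volume) {G : ℝ} (hG : 0 ≤ G)
    (hgG : eLpNorm g 2 volume ≤ ENNReal.ofReal G) (w : ℝ) :
    0 < lamhat p ∧
      |innerL2 g (phihat p) ^ 2 * w ^ 2 / lamhat p - innerL2 g (phi p) ^ 2 * w ^ 2 / lam p| ≤
        headConst C₀ C₂ G * x * (w ^ 2 + innerL2 g (phi p) ^ 2 * w ^ 2 / lam p) := by
  obtain ⟨T, hT⟩ := exists_integralOperator hK
  obtain ⟨T', hT'⟩ := exists_integralOperator hk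
  have hTD : ‖T' - T‖ ≤ D := norm_sub_le_of_kernel hk hK hT' hT hD hkK
  have d := h.isDiagonal hT
  have d' := h'.isDiagonal hT'
  have hq0 : (0 : ℝ) < (p : ℝ) + 1 := by positivity
  have hqm : (p : ℝ) + 1 ≤ m := by exact_mod_cast hp
  have hm1 : (1 : ℝ) ≤ m := by exact_mod_cast (Nat.one_le_iff_ne_zero.2 (by omega))
  have hx0 : 0 ≤ x := le_trans (by positivity) hx
  have hl0 : 0 < lam p := lt_of_lt_of_le (by positivity) (hlam_ge p)
  have hweyl := (d.abs_eigenvalue_sub_le h.antitone h.nonneg d' h'.antitone h'.nonneg p).trans hTD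
  set γ := C₀ * ((p : ℝ) + 1) ^ (-(β + 1)) with hγ
  have hγ0 : 0 < γ := by positivity
  have hev := d.abs_inner_sq_sub_le (p := p) hγ0
    (by rw [abs_of_pos hl0]; linarith [hgap p, h.nonneg (p + 1)])
    (fun q hq => gap_le_abs_sub h.antitone hC₀ (by linarith) hgap hq)
    (d'.orthonormal.1 p) (d'.eigen p) hweyl hTD hg.toLp
  simp only [inner_toLp] at hev
  have hng : ‖hg.toLp‖ ≤ G := by
    rw [Lp.norm_toLp]
    exact ENNReal.toReal_le_of_le_ofReal hG hgG
  have hc : |innerL2 g (phihat p) ^ 2 - innerL2 g (phi p) ^ 2| ≤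
      3 * D / γ * G * (2 * |innerL2 g (phi p)| + 3 * D / γ * G) :=
    hev.trans (by gcongr)
  have hinv : 1 / lam p ≤ (m : ℝ) ^ β / C₂ := by
    rw [div_le_div_iff₀ hl0 hC₂, one_mul]
    calc C₂ = (m : ℝ) ^ β * (C₂ * (m : ℝ) ^ (-β)) := by
          rw [Real.rpow_neg (by positivity)]; field_simp
      _ ≤ (m : ℝ) ^ β * (C₂ * ((p : ℝ) + 1) ^ (-β)) := by
          have := Real.rpow_le_rpow_of_nonpos (z := -β) hq0 hqm (by linarith)
          gcongr
      _ ≤ _ := by gcongr; exact hlam_ge p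
  have hDl' : D / lam p ≤ x * (1 / C₂) := by
    calc D / lam p = D * (1 / lam p) := by ring
      _ ≤ D * ((m : ℝ) ^ β / C₂) := by gcongr
      _ ≤ D * ((m : ℝ) ^ (3 * β / 2 + 1) / C₂) := by
          gcongr
          linarith
      _ = D * (m : ℝ) ^ (3 * β / 2 + 1) * (1 / C₂) := by ring
      _ ≤ _ := by gcongr
  have hDl : D ≤ lam p / 2 := by
    have : D / lam p ≤ 1 / 2 := by
      refine hDl'.trans ?_
      rw [mul_one_div, div_le_iff₀ hC₂]; linarith
    rw [div_le_iff₀ hl0] at this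
    linarith
  have hr : 3 * D / γ / √(lam p) ≤ 3 / (C₀ * √C₂) * x := by
    have e1 : 3 * D / γ = 3 * D / C₀ * ((p : ℝ) + 1) ^ (β + 1) := by
      rw [hγ, Real.rpow_neg hq0.le]; field_simp
    have e2 : 1 / √(lam p) ≤ (m : ℝ) ^ (β / 2) / √C₂ := by
      have := Real.sqrt_le_sqrt hinv
      rw [Real.sqrt_div (by positivity), Real.sqrt_div (by positivity), Real.sqrt_one] at this
      refine this.trans_eq ?_
      rw [Real.sqrt_eq_rpow, ← Real.rpow_mul (by positivity), mul_one_div]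
    calc 3 * D / γ / √(lam p) = 3 * D / C₀ * ((p : ℝ) + 1) ^ (β + 1) * (1 / √(lam p)) := by
          rw [e1]; ring
      _ ≤ 3 * D / C₀ * (m : ℝ) ^ (β + 1) * ((m : ℝ) ^ (β / 2) / √C₂) := by gcongr
      _ = 3 / (C₀ * √C₂) * (D * ((m : ℝ) ^ (β + 1) * (m : ℝ) ^ (β / 2))) := by
          field_simp
      _ = 3 / (C₀ * √C₂) * (D * (m : ℝ) ^ (3 * β / 2 + 1)) := by
          rw [← Real.rpow_add (by positivity)]; ring_nf
      _ ≤ _ := by gcongr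
  obtain ⟨r1, r2⟩ := abs_sq_mul_div_sub_le (w := w) hl0 hweyl hDl (by positivity) hG hc
  refine ⟨r1, r2.trans ?_⟩
  set u := innerL2 g (phi p) ^ 2 * w ^ 2 / lam p with hu
  have hu0 : 0 ≤ u := by positivity
  have hR0 : 0 ≤ 3 * D / γ / √(lam p) := by positivity
  have t1 : 2 * G * (3 * D / γ / √(lam p)) * (w ^ 2 + u) ≤
      2 * G * (3 / (C₀ * √C₂)) * x * (w ^ 2 + u) := by
    have : 2 * G * (3 / (C₀ * √C₂)) * x = 2 * G * (3 / (C₀ * √C₂) * x) := by ring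
    rw [this]; gcongr
  have t2 : 2 * G ^ 2 * (3 * D / γ / √(lam p)) ^ 2 * w ^ 2 ≤
      2 * G ^ 2 * (3 / (C₀ * √C₂)) ^ 2 * x * (w ^ 2 + u) := by
    calc _ ≤ 2 * G ^ 2 * (3 / (C₀ * √C₂) * x) ^ 2 * (w ^ 2 + u) := by gcongr; linarith
      _ = 2 * G ^ 2 * (3 / (C₀ * √C₂)) ^ 2 * (x * x) * (w ^ 2 + u) := by ring
      _ ≤ _ := by gcongr; nlinarith
  have t3 : 2 * (D / lam p) * u ≤ 2 * (1 / C₂) * x * (w ^ 2 + u) := by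
    calc _ ≤ 2 * (x * (1 / C₂)) * (w ^ 2 + u) := by gcongr; nlinarith [sq_nonneg w]
      _ = _ := by ring
  unfold headConst
  linarith

end Truncated

/-! ### Root-n consistency of the empirical covariance kernel. -/

section Sample

/-- The variance of an i.i.d. average. Values in [0,∞] make the bound trivial when the second moment
is infinite, so it can be used at every point of the square without checking moments there. -/
theorem lintegral_enorm_average_sub_sq_le {Ω : Type*} [MeasurableSpace Ω] {P : Measure Ω}
    [IsProbabilityMeasure P] {ξ : ℕ → Ω → ℝ} (hm : ∀ i, Measurable (ξ i)) (hind : iIndepFun ξ P)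
    (hid : ∀ i, IdentDistrib (ξ i) (ξ 0) P P) {n : ℕ} (hn : n ≠ 0) :
    ∫⁻ ω, ‖1 / (n : ℝ) * ∑ i ∈ Finset.range n, ξ i ω - ∫ ω, ξ 0 ω ∂P‖ₑ ^ 2 ∂P ≤
      ENNReal.ofReal (1 / n) * ∫⁻ ω, ‖ξ 0 ω‖ₑ ^ 2 ∂P := by
  have hnpos : (0 : ℝ) < n := by positivity
  by_cases htop : ∫⁻ ω, ‖ξ 0 ω‖ₑ ^ 2 ∂P = ∞
  · rw [htop, ENNReal.mul_top]
    · exact le_top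
    · simpa using hn
  have h0 : MemLp (ξ 0) 2 P := by
    refine ⟨(hm 0).aestronglyMeasurable, ?_⟩
    rw [← eLpNorm_two_sq] at htop
    exact lt_top_iff_ne_top.2 fun h => htop (by rw [h]; simp)
  have hL : ∀ i, MemLp (ξ i) 2 P := fun i => (hid i).memLp_iff.2 h0
  set Y : Ω → ℝ := fun ω => 1 / (n : ℝ) * ∑ i ∈ Finset.range n, ξ i ω with hY
  have hsum : MemLp (∑ i ∈ Finset.range n, ξ i) 2 P := memLp_finsetSum' _ fun i _ => hL i
  have hYL : MemLp Y 2 P := by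
    have := hsum.const_mul (1 / (n : ℝ))
    simpa [hY] using this
  have hmean : ∫ ω, Y ω ∂P = ∫ ω, ξ 0 ω ∂P := by
    rw [hY, integral_const_mul, integral_finsetSum _ fun i _ => (hL i).integrable one_le_two,
      Finset.sum_congr rfl fun i _ => (hid i).integral_eq]
    simp; field_simp
  have hvar : Var[Y; P] ≤ 1 / n * ∫ ω, ξ 0 ω ^ 2 ∂P := by
    have e : Y = fun ω => 1 / (n : ℝ) * (∑ i ∈ Finset.range n, ξ i) ω := by
      ext ω; simp [hY]
    rw [e, variance_const_mul, IndepFun.variance_sum (fun i _ => hL i)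
      (fun i _ j _ hij => hind.indepFun hij), Finset.sum_congr rfl fun i _ => (hid i).variance_eq]
    have := variance_le_expectation_sq (μ := P) (hm 0).aestronglyMeasurable
    simp only [Finset.sum_const, Finset.card_range, nsmul_eq_mul]
    calc (1 / (n : ℝ)) ^ 2 * (n * Var[ξ 0; P]) = 1 / n * Var[ξ 0; P] := by field_simp
      _ ≤ _ := by gcongr; exact this
  have h1 : ∫⁻ ω, ‖Y ω - ∫ ω, ξ 0 ω ∂P‖ₑ ^ 2 ∂P = ENNReal.ofReal Var[Y; P] := by
    rw [ofReal_variance hYL, evariance, hmean]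
  have h2 : ∫⁻ ω, ‖ξ 0 ω‖ₑ ^ 2 ∂P = ENNReal.ofReal (∫ ω, ξ 0 ω ^ 2 ∂P) := by
    rw [ofReal_integral_eq_lintegral_ofReal h0.integrable_sq
      (Eventually.of_forall fun _ => sq_nonneg _)]
    refine lintegral_congr fun ω => ?_
    rw [Real.enorm_eq_ofReal_abs, ← ENNReal.ofReal_pow (abs_nonneg _), sq_abs]
  rw [h1, h2, ← ENNReal.ofReal_mul (by positivity)]
  exact ENNReal.ofReal_le_ofReal hvar

/-- Recentring at a fixed `m`, to be the true mean, turns the kernel into an average of i.i.d. terms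
minus a rank-one correction of second order. -/
theorem empKernel_eq {x : ℕ → I → ℝ} {n : ℕ} (hn : n ≠ 0) (m : I → ℝ) (s t : I) :
    empKernel x n s t = 1 / (n : ℝ) * ∑ i ∈ Finset.range n, (x i s - m s) * (x i t - m t) -
      (sampleMean x n s - m s) * (sampleMean x n t - m t) := by
  have hnpos : (n : ℝ) ≠ 0 := by positivity
  have hs : ∀ t, ∑ i ∈ Finset.range n, x i t = n * sampleMean x n t := by
    intro t; rw [sampleMean]; field_simp
  have e : ∀ (a b : ℝ), ∑ i ∈ Finset.range n, (x i s - a) * (x i t - b) =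
      ∑ i ∈ Finset.range n, x i s * x i t - n * sampleMean x n s * b - n * sampleMean x n t * a
        + n * (a * b) := by
    intro a b
    rw [← hs, ← hs, Finset.sum_mul, Finset.sum_mul, ← Finset.sum_sub_distrib,
      ← Finset.sum_sub_distrib]
    have : (n : ℝ) * (a * b) = ∑ i ∈ Finset.range n, a * b := by simp
    rw [this, ← Finset.sum_add_distrib]
    exact Finset.sum_congr rfl fun i _ => by ring
  rw [empKernel, e, e]
  field_simp; ring

theorem enorm_sub_sq_le (a b : ℝ) : ‖a - b‖ₑ ^ 2 ≤ 2 * ‖a‖ₑ ^ 2 + 2 * ‖b‖ₑ ^ 2 := by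
  simp only [Real.enorm_eq_ofReal_abs, ← ENNReal.ofReal_pow (abs_nonneg _), sq_abs]
  rw [show (2 : ℝ≥0∞) = ENNReal.ofReal 2 by simp, ← ENNReal.ofReal_mul (by norm_num),
    ← ENNReal.ofReal_mul (by norm_num), ← ENNReal.ofReal_add (by positivity) (by positivity)]
  exact ENNReal.ofReal_le_ofReal (by nlinarith [sq_nonneg (a + b)])

/-- This is how the fourth moment of the norm enters: the kernel f(s) f(t) has L² norm ‖f‖². -/
theorem lintegral_prod_enorm_mul_sq {f : I → ℝ} (hf : AEMeasurable f) :
    ∫⁻ z : I × I, ‖f z.1 * f z.2‖ₑ ^ 2 = (∫⁻ t, ‖f t‖ₑ ^ 2) ^ 2 := by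
  have : ∀ z : I × I, ‖f z.1 * f z.2‖ₑ ^ 2 = ‖f z.1‖ₑ ^ 2 * ‖f z.2‖ₑ ^ 2 := fun z => by
    rw [enorm_mul, mul_pow]
  simp only [this]
  rw [Measure.volume_eq_prod, lintegral_prod_mul (hf.enorm.pow_const 2) (hf.enorm.pow_const 2), sq]

theorem memLp_mul_prod {f : I → ℝ} (hf : MemLp f 2 volume) :
    MemLp (fun z : I × I => f z.1 * f z.2) 2 (volume.prod volume) := by
  refine ⟨hf.1.comp_fst.mul hf.1.comp_snd, ?_⟩
  have h := eLpNorm_two_sq (volume.prod volume) fun z : I × I => f z.1 * f z.2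
  rw [← Measure.volume_eq_prod, lintegral_prod_enorm_mul_sq hf.1.aemeasurable, ← eLpNorm_two_sq] at h
  have h2 : (eLpNorm f 2 volume ^ 2) ^ 2 < ∞ := ENNReal.pow_lt_top (ENNReal.pow_lt_top hf.2)
  rw [← h] at h2
  exact (ENNReal.pow_lt_top_iff.1 h2).resolve_right (by norm_num)

variable {Ω : Type*} [MeasurableSpace Ω] {P : Measure Ω}
  {F : Set (I → ℝ)} {X : ℕ → Ω → I → ℝ}

theorem IsIIDSecondOrder.measurable_slice (hX : IsIIDSecondOrder P F X) (i : ℕ) (t : I) :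
    Measurable fun ω => X i ω t :=
  (hX.measurable i).comp measurable_prodMk_right

theorem measurable_sampleMean (hX : IsIIDSecondOrder P F X) (n : ℕ) :
    Measurable (Function.uncurry fun ω t => sampleMean (fun i => X i ω) n t) := by
  have : Measurable fun y : Ω × I => ∑ i ∈ Finset.range n, X i y.1 y.2 :=
    Finset.measurable_sum _ fun i _ => hX.measurable i
  exact this.const_mul _

theorem memLp_empKernel (hX : IsIIDSecondOrder P F X) (hF : ∀ f ∈ F, MemLp f 2 volume) (n : ℕ)
    (ω : Ω) : MemLp (Function.uncurry (empKernel (fun i => X i ω) n)) 2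
      (volume.prod volume : Measure (I × I)) := by
  have hXL : ∀ i, MemLp (X i ω) 2 volume := fun i => hF _ (hX.path_mem i ω)
  have hmean : MemLp (sampleMean (fun i => X i ω) n) 2 volume :=
    (memLp_finsetSum (Finset.range n) fun i _ => hXL i).const_mul (1 / (n : ℝ))
  have : ∀ i, MemLp (fun z : I × I => (X i ω z.1 - sampleMean (fun i => X i ω) n z.1) *
      (X i ω z.2 - sampleMean (fun i => X i ω) n z.2)) 2 (volume.prod volume) :=
    fun i => memLp_mul_prod ((hXL i).sub hmean)
  exact (memLp_finsetSum (Finset.range n) fun i _ => this i).const_mul (1 / (n : ℝ))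

variable [IsProbabilityMeasure P]

/-- The mean function of a process. -/
noncomputable def meanFun (P : Measure Ω) (f : Ω → I → ℝ) (t : I) : ℝ := ∫ ω, f ω t ∂P

theorem measurable_meanFun {f : Ω → I → ℝ} (hf : Measurable (Function.uncurry f)) :
    Measurable (meanFun P f) :=
  (StronglyMeasurable.integral_prod_left hf.stronglyMeasurable).measurable

theorem measurable_uncurry_covKernel {f : Ω → I → ℝ} (hf : Measurable (Function.uncurry f)) :
    Measurable (Function.uncurry (covKernel P f)) := by
  have hm := measurable_meanFun (P := P) hf
  have h : Measurable (Function.uncurry fun (ω : Ω) (z : I × I) =>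
      (f ω z.1 - meanFun P f z.1) * (f ω z.2 - meanFun P f z.2)) := by
    have h1 : Measurable fun y : Ω × (I × I) => f y.1 y.2.1 :=
      hf.comp (measurable_fst.prodMk measurable_snd.fst)
    have h2 : Measurable fun y : Ω × (I × I) => f y.1 y.2.2 :=
      hf.comp (measurable_fst.prodMk measurable_snd.snd)
    exact (h1.sub (hm.comp measurable_snd.fst)).mul (h2.sub (hm.comp measurable_snd.snd))
  exact (StronglyMeasurable.integral_prod_left h.stronglyMeasurable).measurable

theorem lintegral_enorm_sq_meanFun_le {f : Ω → I → ℝ} (hf : Measurable (Function.uncurry f)) :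
    ∫⁻ t, ‖meanFun P f t‖ₑ ^ 2 ≤ ∫⁻ ω, (∫⁻ t, ‖f ω t‖ₑ ^ 2) ∂P := by
  rw [lintegral_lintegral_swap (hf.enorm.pow_const 2).aemeasurable]
  refine lintegral_mono fun t => ?_
  have h : Measurable fun ω => f ω t := hf.comp measurable_prodMk_right
  have := enorm_integral_mul_sq_le (μ := P) (g := fun _ => 1) h.aemeasurable aemeasurable_const
  simpa [meanFun] using this

theorem lintegral_enorm_sq_lt_top {f : Ω → I → ℝ}
    (h4 : ∫⁻ ω, eLpNorm (f ω) 2 volume ^ 4 ∂P < ∞) :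
    ∫⁻ ω, (∫⁻ t, ‖f ω t‖ₑ ^ 2) ∂P < ∞ := by
  have : ∀ ω, ∫⁻ t, ‖f ω t‖ₑ ^ 2 ≤ 1 + eLpNorm (f ω) 2 volume ^ 4 := by
    intro ω
    rw [← eLpNorm_two_sq]
    rcases le_total (eLpNorm (f ω) 2 volume) 1 with h | h
    · exact (pow_le_one' h 2).trans le_self_add
    · exact (pow_le_pow_right₀ h (by norm_num)).trans le_add_self
  refine (lintegral_mono this).trans_lt ?_
  rw [lintegral_add_left measurable_const]
  simpa using h4

theorem ENNReal.add_sq_le_four_mul (a b : ℝ≥0∞) : (a + b) ^ 2 ≤ 4 * a ^ 2 + 4 * b ^ 2 := by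
  have h : ∀ c : ℝ≥0∞, (c + c) ^ 2 = 4 * c ^ 2 := fun c => by ring
  rcases le_total a b with hab | hab
  · calc (a + b) ^ 2 ≤ (b + b) ^ 2 := by gcongr
      _ ≤ _ := by rw [h]; exact le_add_self
  · calc (a + b) ^ 2 ≤ (a + a) ^ 2 := by gcongr
      _ ≤ _ := by rw [h]; exact le_self_add

theorem lintegral_centered_sq_sq_lt_top {f : Ω → I → ℝ} (hf : Measurable (Function.uncurry f))
    (h4 : ∫⁻ ω, eLpNorm (f ω) 2 volume ^ 4 ∂P < ∞) :
    ∫⁻ ω, (∫⁻ t, ‖f ω t - meanFun P f t‖ₑ ^ 2) ^ 2 ∂P < ∞ := by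
  set c := ∫⁻ t, ‖meanFun P f t‖ₑ ^ 2 with hc
  have hctop : c < ∞ := (lintegral_enorm_sq_meanFun_le hf).trans_lt (lintegral_enorm_sq_lt_top h4)
  have hm := measurable_meanFun (P := P) hf
  have hb : ∀ ω, (∫⁻ t, ‖f ω t - meanFun P f t‖ₑ ^ 2) ^ 2 ≤
      16 * eLpNorm (f ω) 2 volume ^ 4 + 16 * c ^ 2 := by
    intro ω
    have h1 : ∫⁻ t, ‖f ω t - meanFun P f t‖ₑ ^ 2 ≤ 2 * eLpNorm (f ω) 2 volume ^ 2 + 2 * c := by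
      rw [eLpNorm_two_sq, hc, ← lintegral_const_mul' _ _ (by simp),
        ← lintegral_const_mul' _ _ (by simp), ← lintegral_add_right _ (by fun_prop)]
      exact lintegral_mono fun t => enorm_sub_sq_le _ _
    calc _ ≤ (2 * eLpNorm (f ω) 2 volume ^ 2 + 2 * c) ^ 2 := by gcongr
      _ ≤ _ := ENNReal.add_sq_le_four_mul _ _
      _ = _ := by ring
  refine (lintegral_mono hb).trans_lt ?_
  rw [lintegral_add_right _ measurable_const, lintegral_const_mul' _ _ (by simp)]
  simp only [lintegral_const, measure_univ, mul_one]
  exact ENNReal.add_lt_top.2 ⟨ENNReal.mul_lt_top (by simp) h4,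
    ENNReal.mul_lt_top (by simp) (ENNReal.pow_lt_top hctop)⟩

theorem measurable_centered_prod (hX : IsIIDSecondOrder P F X) (i : ℕ) :
    Measurable fun y : Ω × (I × I) =>
      (X i y.1 y.2.1 - meanFun P (X 0) y.2.1) * (X i y.1 y.2.2 - meanFun P (X 0) y.2.2) := by
  have hm := measurable_meanFun (P := P) (hX.measurable 0)
  have h1 : Measurable fun y : Ω × (I × I) => X i y.1 y.2.1 :=
    (hX.measurable i).comp (measurable_fst.prodMk measurable_snd.fst)
  have h2 : Measurable fun y : Ω × (I × I) => X i y.1 y.2.2 :=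
    (hX.measurable i).comp (measurable_fst.prodMk measurable_snd.snd)
  exact (h1.sub (hm.comp measurable_snd.fst)).mul (h2.sub (hm.comp measurable_snd.snd))

theorem lintegral_sampleMean_sub_le (hX : IsIIDSecondOrder P F X) {n : ℕ} (hn : n ≠ 0) :
    ∫⁻ ω, (∫⁻ t, ‖sampleMean (fun i => X i ω) n t - meanFun P (X 0) t‖ₑ ^ 2) ∂P ≤
      ENNReal.ofReal (1 / n) * ∫⁻ ω, (∫⁻ t, ‖X 0 ω t‖ₑ ^ 2) ∂P := by
  have hm := measurable_meanFun (P := P) (hX.measurable 0)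
  rw [lintegral_lintegral_swap
      (((measurable_sampleMean hX n).sub (hm.comp measurable_snd)).enorm.pow_const 2).aemeasurable,
    lintegral_lintegral_swap (f := fun ω t => ‖X 0 ω t‖ₑ ^ 2)
      ((hX.measurable 0).enorm.pow_const 2).aemeasurable,
    ← lintegral_const_mul' _ _ (by simp)]
  refine lintegral_mono fun t => ?_
  have ht : Measurable fun x : I → ℝ => x t := measurable_pi_apply t
  exact lintegral_enorm_average_sub_sq_le (fun i => hX.measurable_slice i t)
    (hX.indep.comp (fun _ x => x t) fun _ => ht) (fun i => (hX.ident i).comp ht) hn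

/-- Tonelli reduces the claim to the variance bound at each fixed pair of points, so only
finite-dimensional distributions are used. The covariance kernel is by definition the mean of the
centred product. -/
theorem lintegral_average_centered_prod_le (hX : IsIIDSecondOrder P F X) {n : ℕ} (hn : n ≠ 0) :
    ∫⁻ ω, (∫⁻ z : I × I, ‖1 / (n : ℝ) * ∑ i ∈ Finset.range n,
        (X i ω z.1 - meanFun P (X 0) z.1) * (X i ω z.2 - meanFun P (X 0) z.2) -
          covKernel P (X 0) z.1 z.2‖ₑ ^ 2) ∂P ≤
      ENNReal.ofReal (1 / n) * ∫⁻ ω, (∫⁻ t, ‖X 0 ω t - meanFun P (X 0) t‖ₑ ^ 2) ^ 2 ∂P := by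
  have hm := measurable_meanFun (P := P) (hX.measurable 0)
  have hK := measurable_uncurry_covKernel (P := P) (hX.measurable 0)
  have e : ∀ ω, (∫⁻ t, ‖X 0 ω t - meanFun P (X 0) t‖ₑ ^ 2) ^ 2 =
      ∫⁻ z : I × I, ‖(X 0 ω z.1 - meanFun P (X 0) z.1) *
        (X 0 ω z.2 - meanFun P (X 0) z.2)‖ₑ ^ 2 := by
    intro ω
    rw [lintegral_prod_enorm_mul_sq (f := fun t => X 0 ω t - meanFun P (X 0) t)]
    exact (((hX.measurable 0).comp measurable_prodMk_left).sub hm).aemeasurable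
  simp only [e]
  have hs : Measurable fun y : Ω × (I × I) => ∑ i ∈ Finset.range n,
      (X i y.1 y.2.1 - meanFun P (X 0) y.2.1) * (X i y.1 y.2.2 - meanFun P (X 0) y.2.2) :=
    Finset.measurable_sum _ fun i _ => measurable_centered_prod hX i
  rw [lintegral_lintegral_swap
      (((hs.const_mul _).sub (hK.comp measurable_snd)).enorm.pow_const 2).aemeasurable,
    lintegral_lintegral_swap (f := fun ω (z : I × I) => ‖(X 0 ω z.1 - meanFun P (X 0) z.1) *
        (X 0 ω z.2 - meanFun P (X 0) z.2)‖ₑ ^ 2)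
      ((measurable_centered_prod hX 0).enorm.pow_const 2).aemeasurable,
    ← lintegral_const_mul' _ _ (by simp)]
  refine lintegral_mono fun z => ?_
  have hz : Measurable fun x : I → ℝ =>
      (x z.1 - meanFun P (X 0) z.1) * (x z.2 - meanFun P (X 0) z.2) :=
    ((measurable_pi_apply z.1).sub_const _).mul ((measurable_pi_apply z.2).sub_const _)
  exact lintegral_enorm_average_sub_sq_le
    (ξ := fun i ω => (X i ω z.1 - meanFun P (X 0) z.1) * (X i ω z.2 - meanFun P (X 0) z.2))
    (fun i => (measurable_centered_prod hX i).comp measurable_prodMk_right)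
    (hX.indep.comp (fun _ x => (x z.1 - meanFun P (X 0) z.1) * (x z.2 - meanFun P (X 0) z.2))
      fun _ => hz) (fun i => (hX.ident i).comp hz) hn

theorem eLpNorm_empKernel_sub_sq_le (hX : IsIIDSecondOrder P F X) {n : ℕ} (hn : n ≠ 0) (ω : Ω) :
    eLpNorm (fun z : I × I => empKernel (fun i => X i ω) n z.1 z.2 - covKernel P (X 0) z.1 z.2) 2
        (volume.prod volume) ^ 2 ≤
      2 * (∫⁻ z : I × I, ‖1 / (n : ℝ) * ∑ i ∈ Finset.range n,
        (X i ω z.1 - meanFun P (X 0) z.1) * (X i ω z.2 - meanFun P (X 0) z.2) -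
          covKernel P (X 0) z.1 z.2‖ₑ ^ 2) +
      2 * (∫⁻ t, ‖sampleMean (fun i => X i ω) n t - meanFun P (X 0) t‖ₑ ^ 2) ^ 2 := by
  have hm := measurable_meanFun (P := P) (hX.measurable 0)
  have hf : Measurable fun t => sampleMean (fun i => X i ω) n t - meanFun P (X 0) t :=
    ((measurable_sampleMean hX n).comp measurable_prodMk_left).sub hm
  rw [eLpNorm_two_sq, ← lintegral_prod_enorm_mul_sq hf.aemeasurable,
    ← lintegral_const_mul' _ _ (by simp), ← lintegral_const_mul' _ _ (by simp),
    ← lintegral_add_right, Measure.volume_eq_prod]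
  · refine lintegral_mono fun z => ?_
    rw [empKernel_eq hn (meanFun P (X 0)), sub_right_comm]
    exact enorm_sub_sq_le _ _
  · exact (((hf.comp measurable_fst).mul (hf.comp measurable_snd)).enorm.pow_const 2).const_mul _

theorem tendsto_measure_empKernel (hX : IsIIDSecondOrder P F X)
    (hX4 : ∫⁻ ω, eLpNorm (X 0 ω) 2 volume ^ 4 ∂P < ∞) {κ : ℝ} (hκ : 0 < κ) (hκ' : κ ≤ 1 / 2) :
    Tendsto (fun n : ℕ => P {ω | ¬ eLpNorm (fun z : I × I => empKernel (fun i => X i ω) n z.1 z.2 -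
        covKernel P (X 0) z.1 z.2) 2 (volume.prod volume) ≤
          ENNReal.ofReal ((n : ℝ) ^ (κ - 1 / 2))}) atTop (𝓝 0) := by
  set M₄ := ∫⁻ ω, (∫⁻ t, ‖X 0 ω t - meanFun P (X 0) t‖ₑ ^ 2) ^ 2 ∂P with hM₄
  set M₂ := ∫⁻ ω, (∫⁻ t, ‖X 0 ω t‖ₑ ^ 2) ∂P with hM₂
  have h4 : M₄ < ∞ := lintegral_centered_sq_sq_lt_top (hX.measurable 0) hX4
  have h2 : M₂ < ∞ := lintegral_enorm_sq_lt_top hX4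
  have hm := measurable_meanFun (P := P) (hX.measurable 0)
  have hK := measurable_uncurry_covKernel (P := P) (hX.measurable 0)
  have hlim : Tendsto (fun n : ℕ => ENNReal.ofReal ((4 * M₄.toReal + 2 * M₂.toReal) *
      (n : ℝ) ^ (-(2 * κ)))) atTop (𝓝 0) := by
    rw [← ENNReal.ofReal_zero]
    refine ENNReal.tendsto_ofReal ?_
    have := ((tendsto_rpow_neg_atTop (y := 2 * κ) (by linarith)).comp
      tendsto_natCast_atTop_atTop).const_mul (4 * M₄.toReal + 2 * M₂.toReal)
    simpa using this
  refine tendsto_of_tendsto_of_tendsto_of_le_of_le' tendsto_const_nhds hlim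
    (Eventually.of_forall fun _ => zero_le) ?_
  filter_upwards [eventually_ne_atTop 0] with n hn
  set t : ℝ := (n : ℝ) ^ (κ - 1 / 2) with ht
  have hn0 : (0 : ℝ) < n := by positivity
  have hn1 : (1 : ℝ) ≤ n := by exact_mod_cast Nat.one_le_iff_ne_zero.2 hn
  have ht0 : 0 < t := by positivity
  set A : Ω → ℝ≥0∞ := fun ω => ∫⁻ z : I × I, ‖1 / (n : ℝ) * ∑ i ∈ Finset.range n,
        (X i ω z.1 - meanFun P (X 0) z.1) * (X i ω z.2 - meanFun P (X 0) z.2) -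
          covKernel P (X 0) z.1 z.2‖ₑ ^ 2 with hA
  set B : Ω → ℝ≥0∞ := fun ω =>
    ∫⁻ t, ‖sampleMean (fun i => X i ω) n t - meanFun P (X 0) t‖ₑ ^ 2 with hB
  have hAm : Measurable A := by
    have hs : Measurable fun y : Ω × (I × I) => ∑ i ∈ Finset.range n,
        (X i y.1 y.2.1 - meanFun P (X 0) y.2.1) * (X i y.1 y.2.2 - meanFun P (X 0) y.2.2) :=
      Finset.measurable_sum _ fun i _ => measurable_centered_prod hX i
    exact (((hs.const_mul _).sub (hK.comp measurable_snd)).enorm.pow_const 2).lintegral_prod_right'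
  have hBm : Measurable B :=
    (((measurable_sampleMean hX n).sub
      (hm.comp measurable_snd)).enorm.pow_const 2).lintegral_prod_right'
  -- The thresholds are chosen so that 2 (t²/4) + 2 (t/2)² = t².
  have hsub : {ω | ¬ eLpNorm (fun z : I × I => empKernel (fun i => X i ω) n z.1 z.2 -
        covKernel P (X 0) z.1 z.2) 2 (volume.prod volume) ≤ ENNReal.ofReal t} ⊆
      {ω | ENNReal.ofReal (t ^ 2 / 4) ≤ A ω} ∪ {ω | ENNReal.ofReal (t / 2) ≤ B ω} := by
    intro ω hω
    by_contra hcon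
    simp only [Set.mem_union, Set.mem_ofPred_eq, not_or, not_le] at hcon
    apply hω
    rw [← ENNReal.pow_le_pow_left_iff (n := 2) (by norm_num)]
    refine (eLpNorm_empKernel_sub_sq_le hX hn ω).trans ?_
    calc 2 * A ω + 2 * B ω ^ 2
        ≤ 2 * ENNReal.ofReal (t ^ 2 / 4) + 2 * ENNReal.ofReal (t / 2) ^ 2 := by
          gcongr
          · exact hcon.1.le
          · exact hcon.2.le
      _ = ENNReal.ofReal (2 * (t ^ 2 / 4) + 2 * (t / 2) ^ 2) := by
          rw [ENNReal.ofReal_add (by positivity) (by positivity),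
            ENNReal.ofReal_mul (by norm_num), ENNReal.ofReal_mul (by norm_num),
            ENNReal.ofReal_pow (by positivity)]
          simp
      _ ≤ _ := by
          rw [← ENNReal.ofReal_pow ht0.le]
          refine ENNReal.ofReal_le_ofReal (le_of_eq ?_)
          ring
  refine (measure_mono hsub).trans ((measure_union_le _ _).trans ?_)
  have hPA : P {ω | ENNReal.ofReal (t ^ 2 / 4) ≤ A ω} ≤
      ENNReal.ofReal (4 * M₄.toReal * (n : ℝ) ^ (-(2 * κ))) := by
    refine (meas_ge_le_lintegral_div hAm.aemeasurable (by simpa using by positivity)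
      ENNReal.ofReal_ne_top).trans ?_
    refine (ENNReal.div_le_div_right (lintegral_average_centered_prod_le hX hn) _).trans ?_
    rw [← hM₄, ← ENNReal.ofReal_toReal h4.ne, ← ENNReal.ofReal_mul (by positivity),
      ← ENNReal.ofReal_div_of_pos (by positivity), ENNReal.toReal_ofReal (by positivity)]
    refine ENNReal.ofReal_le_ofReal (le_of_eq ?_)
    have : t ^ 2 * n = (n : ℝ) ^ (2 * κ) := by
      rw [ht, ← Real.rpow_natCast, ← Real.rpow_mul hn0.le]
      nth_rewrite 2 [← Real.rpow_one (n : ℝ)]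
      rw [← Real.rpow_add hn0]
      congr 1; push_cast; ring
    rw [Real.rpow_neg hn0.le, ← this]
    field_simp
  have hPB : P {ω | ENNReal.ofReal (t / 2) ≤ B ω} ≤
      ENNReal.ofReal (2 * M₂.toReal * (n : ℝ) ^ (-(2 * κ))) := by
    refine (meas_ge_le_lintegral_div hBm.aemeasurable (by simpa using by positivity)
      ENNReal.ofReal_ne_top).trans ?_
    refine (ENNReal.div_le_div_right (lintegral_sampleMean_sub_le hX hn) _).trans ?_
    rw [← hM₂, ← ENNReal.ofReal_toReal h2.ne, ← ENNReal.ofReal_mul (by positivity),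
      ← ENNReal.ofReal_div_of_pos (by positivity), ENNReal.toReal_ofReal (by positivity)]
    refine ENNReal.ofReal_le_ofReal ?_
    have h1 : t * n = (n : ℝ) ^ (κ + 1 / 2) := by
      rw [ht]
      nth_rewrite 2 [← Real.rpow_one (n : ℝ)]
      rw [← Real.rpow_add hn0]
      congr 1; ring
    -- The correction term has the better rate n^(-(κ+1/2)); since κ ≤ 1/2 it is weakened to the
    -- common n^(-2κ).
    have h3 : (n : ℝ) ^ (2 * κ) ≤ t * n := by
      rw [h1]
      exact Real.rpow_le_rpow_of_exponent_le hn1 (by linarith)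
    rw [Real.rpow_neg hn0.le]
    calc 1 / (n : ℝ) * M₂.toReal / (t / 2) = 2 * M₂.toReal * (t * n)⁻¹ := by field_simp
      _ ≤ _ := by gcongr
  calc _ ≤ _ := add_le_add hPA hPB
    _ = _ := by
      rw [← ENNReal.ofReal_add (by positivity) (by positivity)]
      ring_nf

end Sample

/-! ### Size of the truncation level. -/

section Truncation

variable {lam : ℕ → ℝ} {β C₀ C₁ C₂ c : ℝ} {δ : ℕ → ℝ}

/-- Convergence to 0 and `0 < d` make the index set bounded, so that its `sSup` is a genuine maximum
(or 0 if the set is empty). With zero-based indices the entries kept are exactly those with `p <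
truncLevel lam d`. -/
theorem lt_truncLevel_iff (hanti : Antitone lam) (hlim : Tendsto lam atTop (𝓝 0)) {d : ℝ}
    (hd : 0 < d) {p : ℕ} : p < truncLevel lam d ↔ d ≤ lam p := by
  have hbdd : BddAbove ((fun p => p + 1) '' {p : ℕ | d ≤ lam p}) := by
    obtain ⟨N, hN⟩ := eventually_atTop.1 (hlim.eventually_lt_const hd)
    refine ⟨N, ?_⟩
    rintro _ ⟨q, hq, rfl⟩
    by_contra! hlt
    exact absurd (hN q (by simpa using Nat.lt_succ_iff.1 hlt)) (not_lt.2 hq)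
  constructor
  · intro h
    have hne : ((fun p => p + 1) '' {p : ℕ | d ≤ lam p}).Nonempty := by
      by_contra hne
      rw [Set.not_nonempty_iff_eq_empty] at hne
      rw [truncLevel, hne] at h
      simp at h
    obtain ⟨q, hq, hq'⟩ := Nat.sSup_mem hne hbdd
    have : p < q + 1 := by rw [truncLevel, ← hq'] at h; exact h
    exact le_trans hq (hanti (Nat.lt_succ_iff.1 this))
  · intro h
    exact Nat.lt_of_succ_le (le_csSup hbdd ⟨p, h, rfl⟩)

theorem tendsto_zero_of_le_rpow (hβ : 0 < β) (hnonneg : ∀ p, 0 ≤ lam p)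
    (hlam_le : ∀ p : ℕ, lam p ≤ C₁ * ((p : ℝ) + 1) ^ (-β)) : Tendsto lam atTop (𝓝 0) := by
  refine squeeze_zero hnonneg hlam_le ?_
  have h1 : Tendsto (fun p : ℕ => (p : ℝ) + 1) atTop atTop :=
    tendsto_atTop_add_const_right _ _ tendsto_natCast_atTop_atTop
  simpa using ((tendsto_rpow_neg_atTop hβ).comp h1).const_mul C₁

theorem eventually_threshold_pos (hc : 0 < c)
    (hδ_ge : ∀ᶠ n : ℕ in atTop,
      c * (Real.sqrt n / Real.log n) ^ (-(β / (2 * β + 1))) ≤ δ n) :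
    ∀ᶠ n in atTop, 0 < δ n := by
  filter_upwards [hδ_ge, eventually_ge_atTop 2] with n hn h2
  have h2' : (2 : ℝ) ≤ n := by exact_mod_cast h2
  have : 0 < Real.log n := Real.log_pos (by linarith)
  have : 0 < Real.sqrt n / Real.log n := by positivity
  exact lt_of_lt_of_le (by positivity) hn

theorem eventually_truncLevel_le (hβ : 0 < β) (hanti : Antitone lam) (hnonneg : ∀ p, 0 ≤ lam p)
    (hC₁ : 0 < C₁) (hlam_le : ∀ p : ℕ, lam p ≤ C₁ * ((p : ℝ) + 1) ^ (-β)) (hc : 0 < c)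
    (hδ_ge : ∀ᶠ n : ℕ in atTop,
      c * (Real.sqrt n / Real.log n) ^ (-(β / (2 * β + 1))) ≤ δ n) :
    ∀ᶠ n : ℕ in atTop, (truncLevel lam (δ n) : ℝ) ≤
      (C₁ / c) ^ (1 / β) * (n : ℝ) ^ (1 / (2 * (2 * β + 1))) := by
  have hlim := tendsto_zero_of_le_rpow hβ hnonneg hlam_le
  filter_upwards [hδ_ge, eventually_threshold_pos hc hδ_ge, eventually_ge_atTop 3] with n hn hpos h3
  rcases Nat.eq_zero_or_pos (truncLevel lam (δ n)) with h0 | hM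
  · rw [h0]; push_cast; positivity
  obtain ⟨q, hq⟩ : ∃ q, truncLevel lam (δ n) = q + 1 := ⟨_, (Nat.sub_add_cancel hM).symm⟩
  have hδq : δ n ≤ lam q := (lt_truncLevel_iff hanti hlim hpos).1 (by omega)
  rw [hq]; push_cast
  have hn3 : (3 : ℝ) ≤ n := by exact_mod_cast h3
  -- The logarithm in the threshold is needed only as a factor at least 1, and is then dropped.
  have hlog : 1 ≤ Real.log n := by
    rw [Real.le_log_iff_exp_le (by linarith)]
    exact (Real.exp_one_lt_d9.le.trans (by norm_num)).trans hn3
  have hs0 : 0 < √(n : ℝ) := Real.sqrt_pos.2 (by linarith)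
  set θ := β / (2 * β + 1) with hθ
  have hθ0 : 0 < θ := by positivity
  have h1 : c * √(n : ℝ) ^ (-θ) ≤ C₁ * ((q : ℝ) + 1) ^ (-β) := by
    calc c * √(n : ℝ) ^ (-θ) ≤ c * (√(n : ℝ) / Real.log n) ^ (-θ) := by
          have := Real.rpow_le_rpow_of_nonpos (z := -θ)
            (by positivity : 0 < √(n : ℝ) / Real.log n) (div_le_self hs0.le hlog) (by linarith)
          gcongr
      _ ≤ _ := hn.trans (hδq.trans (hlam_le q))
  rw [Real.rpow_neg hs0.le, Real.rpow_neg (by positivity), ← div_eq_mul_inv, ← div_eq_mul_inv,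
    div_le_div_iff₀ (by positivity) (by positivity)] at h1
  have h2 : ((q : ℝ) + 1) ^ β ≤ C₁ / c * √(n : ℝ) ^ θ := by
    rw [div_mul_eq_mul_div, le_div_iff₀ hc]; linarith
  have h4 := Real.rpow_le_rpow (by positivity) h2 (by positivity : 0 ≤ 1 / β)
  rw [← Real.rpow_mul (by positivity), mul_one_div_cancel hβ.ne', Real.rpow_one,
    Real.mul_rpow (by positivity) (by positivity), ← Real.rpow_mul hs0.le,
    Real.sqrt_eq_rpow, ← Real.rpow_mul (by positivity)] at h4
  refine h4.trans_eq ?_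
  congr 2
  rw [hθ]; field_simp

/-- The entry at the zero-based index `truncLevel lam d` is the first one dropped, so C₂ (M+1)^(-β)
< d; raise this to the power 2α/β. -/
theorem rpow_truncLevel_le (hβ : 0 < β) (hC₂ : 0 < C₂) (hanti : Antitone lam)
    (hlim : Tendsto lam atTop (𝓝 0))
    (hlam_ge : ∀ p : ℕ, C₂ * ((p : ℝ) + 1) ^ (-β) ≤ lam p) {d : ℝ} (hd : 0 < d) {α : ℝ}
    (hα : 0 < α) :
    ((truncLevel lam d : ℝ) + 1) ^ (-(2 * α)) ≤ (d / C₂) ^ (2 * α / β) := by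
  have h1 : lam (truncLevel lam d) < d := by
    by_contra! h
    exact lt_irrefl _ ((lt_truncLevel_iff hanti hlim hd).2 h)
  have h2 : ((truncLevel lam d : ℝ) + 1) ^ (-β) ≤ d / C₂ := by
    rw [le_div_iff₀ hC₂]; linarith [hlam_ge (truncLevel lam d)]
  have h3 := Real.rpow_le_rpow (by positivity) h2 (by positivity : 0 ≤ 2 * α / β)
  rw [← Real.rpow_mul (by positivity)] at h3
  refine le_of_eq_of_le ?_ h3
  congr 1; field_simp

theorem eventually_le_truncLevel (hanti : Antitone lam) (hlim : Tendsto lam atTop (𝓝 0))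
    (hpos : ∀ p, 0 < lam p) (hδ : Tendsto δ atTop (𝓝 0)) (hδpos : ∀ᶠ n in atTop, 0 < δ n)
    (m : ℕ) : ∀ᶠ n in atTop, m ≤ truncLevel lam (δ n) := by
  filter_upwards [hδpos, hδ.eventually_lt_const (hpos m)] with n h1 h2
  exact ((lt_truncLevel_iff hanti hlim h1).2 h2.le).le

end Truncation

/-! ### Head and tail of the weighted norms. -/

section WeightedNorm

theorem weightedNormSq_mono {ι : Type*} {lam : ι → ℝ} {phi : ι → I → ℝ} {w w' : ι → ℝ}
    (h : ∀ p, w p ^ 2 ≤ w' p ^ 2) (f : I → ℝ) :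
    weightedNormSq lam phi w f ≤ weightedNormSq lam phi w' f := by
  refine ENNReal.tsum_le_tsum fun p => ENNReal.div_le_div_right (ENNReal.ofReal_le_ofReal ?_) _
  exact mul_le_mul_of_nonneg_left (h p) (sq_nonneg _)

theorem ofReal_le_add_of_abs_sub_le {v u w e : ℝ} (hu : 0 ≤ u) (he : 0 ≤ e)
    (h : |v - u| ≤ e * (w ^ 2 + u)) :
    ENNReal.ofReal v ≤ ENNReal.ofReal u +
        ENNReal.ofReal e * (ENNReal.ofReal (w ^ 2) + ENNReal.ofReal u) ∧
      ENNReal.ofReal u ≤ ENNReal.ofReal v +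
        ENNReal.ofReal e * (ENNReal.ofReal (w ^ 2) + ENNReal.ofReal u) := by
  have hw := sq_nonneg w
  rw [← ENNReal.ofReal_add hw hu, ← ENNReal.ofReal_mul he]
  have h' := abs_le.1 h
  constructor
  · rw [← ENNReal.ofReal_add hu (by positivity)]
    exact ENNReal.ofReal_le_ofReal (by linarith)
  · refine le_trans (ENNReal.ofReal_le_ofReal (by linarith : u ≤ v + e * (w ^ 2 + u))) ?_
    exact ENNReal.ofReal_add_le

variable {n M : ℕ} {lam : ℕ → ℝ} {phi : ℕ → I → ℝ} {lamhat : Fin n → ℝ} {phihat : Fin n → I → ℝ}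
  {w : ℕ → ℝ} {g : I → ℝ} {e : ℝ}

/-- Two additive one-sided bounds replace an absolute difference because the norms may be infinite.
The tail appears only in the second, the sample norm having no terms there. -/
theorem sampleNormSq_bounds (hpos : ∀ p, 0 < lam p) (he : 0 ≤ e)
    (hw : Summable fun p => w p ^ 2)
    (h : ∀ p : Fin n, (p : ℕ) < M → 0 < lamhat p ∧
      |innerL2 g (phihat p) ^ 2 * w p ^ 2 / lamhat p - innerL2 g (phi p) ^ 2 * w p ^ 2 / lam p| ≤
        e * (w p ^ 2 + innerL2 g (phi p) ^ 2 * w p ^ 2 / lam p)) :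
    sampleNormSq M lamhat phihat w g ≤ weightedNormSq lam phi w g +
        ENNReal.ofReal e * (ENNReal.ofReal (∑' p, w p ^ 2) + weightedNormSq lam phi w g) ∧
      weightedNormSq lam phi w g ≤ sampleNormSq M lamhat phihat w g +
        ENNReal.ofReal e * (ENNReal.ofReal (∑' p, w p ^ 2) + weightedNormSq lam phi w g) +
        ∑' p, ENNReal.ofReal (innerL2 g (phi (p + min M n)) ^ 2 * w (p + min M n) ^ 2) /
          ENNReal.ofReal (lam (p + min M n)) := by
  set m := min M n with hm
  set U : ℕ → ℝ≥0∞ := fun p =>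
    ENNReal.ofReal (innerL2 g (phi p) ^ 2 * w p ^ 2) / ENNReal.ofReal (lam p) with hU
  set V : Fin m → ℝ≥0∞ := fun p => ENNReal.ofReal
    (innerL2 g (phihat (p.castLE (min_le_right M n))) ^ 2 * w p ^ 2) /
      ENNReal.ofReal (lamhat (p.castLE (min_le_right M n))) with hV
  have hN : weightedNormSq lam phi w g = ∑' p, U p := rfl
  have hNhat : sampleNormSq M lamhat phihat w g = ∑ p, V p := tsum_fintype _
  have hterm : ∀ p : Fin m, V p ≤ U p + ENNReal.ofReal e * (ENNReal.ofReal (w p ^ 2) + U p) ∧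
      U p ≤ V p + ENNReal.ofReal e * (ENNReal.ofReal (w p ^ 2) + U p) := by
    intro p
    obtain ⟨h1, h2⟩ := h (p.castLE (min_le_right M n)) (lt_of_lt_of_le p.2 (min_le_left M n))
    have := ofReal_le_add_of_abs_sub_le
      (div_nonneg (mul_nonneg (sq_nonneg _) (sq_nonneg _)) (hpos p).le) he h2
    -- Positivity of the empirical eigenvalue makes the [0,∞] quotient the real one.
    rw [ENNReal.ofReal_div_of_pos h1] at this
    simp only [hU, hV]
    rw [← ENNReal.ofReal_div_of_pos (hpos p)]
    exact this
  have hUle : ∑ p : Fin m, U p ≤ ∑' p, U p := by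
    rw [Fin.sum_univ_eq_sum_range U m]
    exact ENNReal.sum_le_tsum _
  have hWle : ∑ p : Fin m, ENNReal.ofReal (w p ^ 2) ≤ ENNReal.ofReal (∑' p, w p ^ 2) := by
    rw [Fin.sum_univ_eq_sum_range (fun p => ENNReal.ofReal (w p ^ 2)) m,
      ENNReal.ofReal_tsum_of_nonneg (fun _ => sq_nonneg _) hw]
    exact ENNReal.sum_le_tsum _
  have herr : ∑ p : Fin m, ENNReal.ofReal e * (ENNReal.ofReal (w p ^ 2) + U p) ≤
      ENNReal.ofReal e * (ENNReal.ofReal (∑' p, w p ^ 2) + ∑' p, U p) := by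
    rw [← Finset.mul_sum, Finset.sum_add_distrib]
    gcongr
  rw [hN, hNhat]
  constructor
  · calc ∑ p, V p ≤ _ := Finset.sum_le_sum fun p _ => (hterm p).1
      _ = _ := Finset.sum_add_distrib
      _ ≤ _ := add_le_add hUle herr
  · have hsplit : ∑' p, U p = ∑ p : Fin m, U p + ∑' p, U (p + m) := by
      rw [Fin.sum_univ_eq_sum_range U m]
      exact (ENNReal.summable.sum_add_tsum_nat_add' (k := m)).symm
    calc ∑' p, U p = ∑ p : Fin m, U p + ∑' p, U (p + m) := hsplit
      _ ≤ _ := by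
        refine add_le_add ?_ le_rfl
        calc ∑ p : Fin m, U p ≤ _ := Finset.sum_le_sum fun p _ => (hterm p).2
          _ = _ := Finset.sum_add_distrib
          _ ≤ _ := add_le_add le_rfl herr

theorem IsEigensystem.innerL2_sq_le_one {ι : Type*} [Preorder ι] {K : I → I → ℝ} {lam : ι → ℝ}
    {phi : ι → I → ℝ} (h : IsEigensystem K lam phi) (hg : MemLp g 2 volume)
    (hg1 : eLpNorm g 2 volume ≤ 1) (p : ι) : innerL2 g (phi p) ^ 2 ≤ 1 := by
  have h1 : ‖hg.toLp‖ ≤ 1 := by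
    rw [Lp.norm_toLp]
    exact ENNReal.toReal_le_of_le_ofReal zero_le_one (by simpa using hg1)
  have h2 : ‖(h.memLp p).toLp‖ = 1 := by
    have := inner_toLp (h.memLp p) (h.memLp p)
    rw [h.norm_one, real_inner_self_eq_norm_sq] at this
    nlinarith [norm_nonneg (h.memLp p).toLp]
  have h3 := abs_real_inner_le_norm hg.toLp (h.memLp p).toLp
  rw [inner_toLp, h2, mul_one] at h3
  rw [← sq_abs]
  exact pow_le_one₀ (abs_nonneg _) (h3.trans h1)

variable {a b : ℕ → ℝ} {α : ℝ}

/-- Each squared weight beyond `m` is at most (m+1)^(-2α) times b_p², and the remaining sum is part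
of the b-norm. -/
theorem tsum_tail_le {m : ℕ} (hα : 0 < α)
    (hab : ∀ p ≥ m, |a p| ≤ b p * ((p : ℝ) + 1) ^ (-α))
    (hgb : weightedNormSq lam phi b g ≤ 1) :
    ∑' p, ENNReal.ofReal (innerL2 g (phi (p + m)) ^ 2 * a (p + m) ^ 2) /
      ENNReal.ofReal (lam (p + m)) ≤ ENNReal.ofReal (((m : ℝ) + 1) ^ (-(2 * α))) := by
  set R := ((m : ℝ) + 1) ^ (-(2 * α)) with hR
  have hterm : ∀ p, ENNReal.ofReal (innerL2 g (phi (p + m)) ^ 2 * a (p + m) ^ 2) /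
      ENNReal.ofReal (lam (p + m)) ≤
      ENNReal.ofReal R * (ENNReal.ofReal (innerL2 g (phi (p + m)) ^ 2 * b (p + m) ^ 2) /
      ENNReal.ofReal (lam (p + m))) := by
    intro p
    rw [← mul_div_assoc, ← ENNReal.ofReal_mul (by positivity)]
    refine ENNReal.div_le_div_right (ENNReal.ofReal_le_ofReal ?_) _
    have h1 := pow_le_pow_left₀ (abs_nonneg _) (hab (p + m) (by omega)) 2
    rw [sq_abs, mul_pow] at h1
    have h2 : ((((p + m : ℕ) : ℝ) + 1) ^ (-α)) ^ 2 ≤ R := by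
      rw [← Real.rpow_natCast, ← Real.rpow_mul (by positivity), hR]
      have : -α * ((2 : ℕ) : ℝ) = -(2 * α) := by push_cast; ring
      rw [this]
      exact Real.rpow_le_rpow_of_nonpos (by positivity) (by push_cast; linarith [p.cast_nonneg (α := ℝ)])
        (by linarith)
    calc _ ≤ innerL2 g (phi (p + m)) ^ 2 * (b (p + m) ^ 2 * R) := by
          gcongr
          exact h1.trans (by gcongr)
      _ = _ := by ring
  calc _ ≤ _ := ENNReal.tsum_le_tsum hterm
    _ = _ := ENNReal.tsum_mul_left
    _ ≤ ENNReal.ofReal R * 1 := by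
      gcongr
      refine le_trans ?_ hgb
      exact (ENNReal.tsum_comp_le_tsum_of_injective (add_left_injective m) _)
    _ = _ := mul_one _

theorem summable_sq_of_eventually_le (hα : 0 < α) (hb : Summable fun p => b p ^ 2)
    (hab : ∀ᶠ p : ℕ in atTop, |a p| ≤ b p * ((p : ℝ) + 1) ^ (-α)) :
    Summable fun p => a p ^ 2 := by
  refine Summable.of_norm_bounded_eventually_nat hb ?_
  filter_upwards [hab] with p hp
  rw [Real.norm_of_nonneg (sq_nonneg _), ← sq_abs]
  have h1 : ((p : ℝ) + 1) ^ (-α) ≤ 1 :=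
    Real.rpow_le_one_of_one_le_of_nonpos (by linarith [p.cast_nonneg (α := ℝ)]) (by linarith)
  have h0 : 0 < ((p : ℝ) + 1) ^ (-α) := by positivity
  -- The sign of `b p` is not assumed; it is forced by 0 ≤ |a p|.
  have hb0 : 0 ≤ b p := by
    by_contra! hneg
    nlinarith [abs_nonneg (a p), mul_neg_of_neg_of_pos hneg h0]
  gcongr
  nlinarith

/-- On the unit balls the squared modified norm is bounded by a constant. -/
theorem exists_weightedNormSq_le {K : I → I → ℝ} (h : IsEigensystem K lam phi)
    (hpos : ∀ p, 0 < lam p) (hα : 0 < α)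
    (hab : ∀ᶠ p : ℕ in atTop, |a p| ≤ b p * ((p : ℝ) + 1) ^ (-α)) :
    ∃ V : ℝ, 0 ≤ V ∧ ∀ g : I → ℝ, MemLp g 2 volume → eLpNorm g 2 volume ≤ 1 →
      weightedNormSq lam phi b g ≤ 1 → weightedNormSq lam phi a g ≤ ENNReal.ofReal V := by
  obtain ⟨m, hm⟩ := eventually_atTop.1 hab
  have hs : 0 ≤ ∑ p ∈ Finset.range m, a p ^ 2 / lam p :=
    Finset.sum_nonneg fun p _ => div_nonneg (sq_nonneg _) (hpos p).le
  refine ⟨∑ p ∈ Finset.range m, a p ^ 2 / lam p + 1, by positivity, fun g hg hg1 hgb => ?_⟩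
  rw [weightedNormSq, ← ENNReal.summable.sum_add_tsum_nat_add' (k := m),
    ENNReal.ofReal_add hs zero_le_one]
  refine add_le_add ?_ ?_
  · rw [ENNReal.ofReal_sum_of_nonneg fun p _ => div_nonneg (sq_nonneg _) (hpos p).le]
    refine Finset.sum_le_sum fun p _ => ?_
    rw [← ENNReal.ofReal_div_of_pos (hpos p)]
    refine ENNReal.ofReal_le_ofReal ?_
    have := hpos p
    gcongr
    exact mul_le_of_le_one_left (sq_nonneg _) (h.innerL2_sq_le_one hg hg1 p)
  · refine (tsum_tail_le hα hm hgb).trans (ENNReal.ofReal_le_ofReal ?_)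
    exact Real.rpow_le_one_of_one_le_of_nonpos (by linarith [m.cast_nonneg (α := ℝ)]) (by linarith)

end WeightedNorm

/-- The exponent of the rate of convergence. -/
noncomputable def rateExponent (β : ℝ) : ℝ := β / (8 * (2 * β + 1))

theorem rateExponent_pos {β : ℝ} (hβ : 0 < β) : 0 < rateExponent β := by
  unfold rateExponent; positivity

theorem rateExponent_le_half {β : ℝ} (hβ : 0 < β) : rateExponent β ≤ 1 / 2 := by
  unfold rateExponent
  rw [div_le_div_iff₀ (by positivity) (by norm_num)]
  linarith

theorem tendsto_natCast_rpow_neg {κ : ℝ} (hκ : 0 < κ) :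
    Tendsto (fun n : ℕ => (n : ℝ) ^ (-κ)) atTop (𝓝 0) :=
  (tendsto_rpow_neg_atTop hκ).comp tendsto_natCast_atTop_atTop

/-! ### Deterministic comparison for kernels close to the covariance kernel. -/

section Deterministic

variable {K : I → I → ℝ} {lam : ℕ → ℝ} {phi : ℕ → I → ℝ} {β C₀ C₁ C₂ c : ℝ} {δ : ℕ → ℝ}

/-- Deterministic comparison of the squared norms when the empirical kernel is within
`n ^ (κ - 1 / 2)` of the covariance kernel. -/
theorem eventually_sampleNormSq_bounds (hKm : Measurable (Function.uncurry K))
    (h : IsEigensystem K lam phi) (hβ : 0 < β) (hC₀ : 0 < C₀) (hC₁ : 0 < C₁) (hC₂ : 0 < C₂)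
    (hlam_le : ∀ p : ℕ, lam p ≤ C₁ * ((p : ℝ) + 1) ^ (-β))
    (hlam_ge : ∀ p : ℕ, C₂ * ((p : ℝ) + 1) ^ (-β) ≤ lam p)
    (hgap : ∀ p : ℕ, C₀ * ((p : ℝ) + 1) ^ (-(β + 1)) ≤ lam p - lam (p + 1)) (hc : 0 < c)
    (hδ_ge : ∀ᶠ n : ℕ in atTop,
      c * (Real.sqrt n / Real.log n) ^ (-(β / (2 * β + 1))) ≤ δ n) {G : ℝ} (hG : 0 ≤ G) :
    ∃ B : ℝ, 0 ≤ B ∧ ∀ᶠ n : ℕ in atTop, ∀ (k : I → I → ℝ) (lamhat : Fin n → ℝ)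
      (phihat : Fin n → I → ℝ), MemLp (Function.uncurry k) 2 (volume.prod volume) →
      IsEigensystem k lamhat phihat →
      eLpNorm (fun z : I × I => k z.1 z.2 - K z.1 z.2) 2 (volume.prod volume) ≤
        ENNReal.ofReal ((n : ℝ) ^ (rateExponent β - 1 / 2)) →
      ∀ g : I → ℝ, MemLp g 2 volume → eLpNorm g 2 volume ≤ ENNReal.ofReal G →
      ∀ w : ℕ → ℝ, Summable (fun p => w p ^ 2) →
      sampleNormSq (truncLevel lam (δ n)) lamhat phihat w g ≤ weightedNormSq lam phi w g +
        ENNReal.ofReal (B * (n : ℝ) ^ (-rateExponent β)) *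
          (ENNReal.ofReal (∑' p, w p ^ 2) + weightedNormSq lam phi w g) ∧
      weightedNormSq lam phi w g ≤ sampleNormSq (truncLevel lam (δ n)) lamhat phihat w g +
        ENNReal.ofReal (B * (n : ℝ) ^ (-rateExponent β)) *
          (ENNReal.ofReal (∑' p, w p ^ 2) + weightedNormSq lam phi w g) +
        ∑' p, ENNReal.ofReal (innerL2 g (phi (p + truncLevel lam (δ n))) ^ 2 *
          w (p + truncLevel lam (δ n)) ^ 2) /
            ENNReal.ofReal (lam (p + truncLevel lam (δ n))) := by
  set κ := rateExponent β with hκ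
  have hκ0 : 0 < κ := rateExponent_pos hβ
  set C' := (C₁ / c) ^ (1 / β) with hC'
  have hC'0 : 0 ≤ C' := by positivity
  set C'' := C' ^ (3 * β / 2 + 1) with hC''
  have hC''0 : 0 ≤ C'' := by positivity
  have hpos : ∀ p, 0 < lam p := fun p => lt_of_lt_of_le (by positivity) (hlam_ge p)
  have hQ := headConst_nonneg hC₀ hC₂ hG
  have hx1 : ∀ᶠ n : ℕ in atTop, C'' * (n : ℝ) ^ (-κ) ≤ min 1 (C₂ / 2) := by
    have := (tendsto_natCast_rpow_neg hκ0).const_mul C''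
    rw [mul_zero] at this
    exact this.eventually_le_const (by positivity)
  -- The exponent is less than 1, so eventually the truncation level is at most `n` and the minimum
  -- with `n` is inactive.
  have hMn : ∀ᶠ n : ℕ in atTop, C' * (n : ℝ) ^ (1 / (2 * (2 * β + 1))) ≤ n := by
    have hθ : 0 < 1 - 1 / (2 * (2 * β + 1)) := by
      rw [sub_pos, div_lt_one (by positivity)]; linarith
    have := (tendsto_natCast_rpow_neg hθ).const_mul C'
    rw [mul_zero] at this
    filter_upwards [this.eventually_le_const zero_lt_one, eventually_gt_atTop 0] with n hn hn0
    have hn0' : (0 : ℝ) < n := by exact_mod_cast hn0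
    calc C' * (n : ℝ) ^ (1 / (2 * (2 * β + 1)))
        = C' * (n : ℝ) ^ (-(1 - 1 / (2 * (2 * β + 1)))) * n := by
          rw [mul_assoc]
          nth_rewrite 3 [← Real.rpow_one (n : ℝ)]
          rw [← Real.rpow_add hn0']
          congr 2; ring
      _ ≤ 1 * n := by gcongr
      _ = n := one_mul _
  refine ⟨headConst C₀ C₂ G * C'', by positivity, ?_⟩
  filter_upwards [hx1, hMn, eventually_truncLevel_le hβ h.antitone h.nonneg hC₁ hlam_le hc hδ_ge,
    eventually_gt_atTop 0] with n hx hMn hM hn0 k lamhat phihat hk hhat hD g hg hgG w hw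
  have hn0' : (0 : ℝ) < n := by exact_mod_cast hn0
  have hMle : truncLevel lam (δ n) ≤ n := by exact_mod_cast hM.trans hMn
  have hd : MemLp (fun z : I × I => k z.1 z.2 - K z.1 z.2) 2 (volume.prod volume) :=
    ⟨hk.1.sub hKm.aestronglyMeasurable, hD.trans_lt ENNReal.ofReal_lt_top⟩
  -- K is square integrable as the difference of `k` and `k - K`.
  have hK : MemLp (Function.uncurry K) 2 (volume.prod volume) := by
    have := hk.sub hd
    convert this using 1
    ext z
    simp [Function.uncurry]
  have hxn : (n : ℝ) ^ (κ - 1 / 2) * (truncLevel lam (δ n) : ℝ) ^ (3 * β / 2 + 1) ≤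
      C'' * (n : ℝ) ^ (-κ) := by
    calc _ ≤ (n : ℝ) ^ (κ - 1 / 2) *
          (C' * (n : ℝ) ^ (1 / (2 * (2 * β + 1)))) ^ (3 * β / 2 + 1) := by gcongr
      _ = C'' * ((n : ℝ) ^ (κ - 1 / 2) *
          (n : ℝ) ^ (1 / (2 * (2 * β + 1)) * (3 * β / 2 + 1))) := by
        rw [Real.mul_rpow hC'0 (by positivity), ← Real.rpow_mul hn0'.le]; ring
      _ = _ := by
        rw [← Real.rpow_add hn0']
        congr 2
        -- Here -1/2 + (3β/2+1)/(2(2β+1)) = -β/(4(2β+1)) = -2κ: half of this spare decay pays for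
        -- the n^κ in the kernel error, the other half is the rate.
        rw [hκ, rateExponent]; field_simp; ring
  have hb := sampleNormSq_bounds (M := truncLevel lam (δ n)) (lamhat := lamhat) (phihat := phihat)
    (phi := phi) (g := g) (e := headConst C₀ C₂ G * (C'' * (n : ℝ) ^ (-κ))) hpos (by positivity) hw
    (fun p hp => abs_sample_term_sub_le hk hK h hhat hβ hC₀ hC₂ hlam_ge hgap (by positivity) hD hxn
      (hx.trans (min_le_left _ _)) (hx.trans (min_le_right _ _)) p hp hg hG hgG (w p))
  rw [min_eq_left hMle, ← mul_assoc] at hb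
  exact hb

variable {a b : ℕ → ℝ} {α : ℝ}

/-- Uniform deterministic comparison over the unit balls. -/
theorem eventually_supError_le {F : Set (I → ℝ)} (hF : ∀ f ∈ F, MemLp f 2 volume)
    (hKm : Measurable (Function.uncurry K))
    (h : IsEigensystem K lam phi) (hβ : 0 < β) (hC₀ : 0 < C₀) (hC₁ : 0 < C₁) (hC₂ : 0 < C₂)
    (hlam_le : ∀ p : ℕ, lam p ≤ C₁ * ((p : ℝ) + 1) ^ (-β))
    (hlam_ge : ∀ p : ℕ, C₂ * ((p : ℝ) + 1) ^ (-β) ≤ lam p)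
    (hgap : ∀ p : ℕ, C₀ * ((p : ℝ) + 1) ^ (-(β + 1)) ≤ lam p - lam (p + 1))
    (hα : 0 < α) (hb : Summable fun p => b p ^ 2)
    (hab : ∀ᶠ p : ℕ in atTop, |a p| ≤ b p * ((p : ℝ) + 1) ^ (-α))
    (hδ : Tendsto δ atTop (𝓝 0)) (hc : 0 < c)
    (hδ_ge : ∀ᶠ n : ℕ in atTop,
      c * (Real.sqrt n / Real.log n) ^ (-(β / (2 * β + 1))) ≤ δ n) :
    ∃ B : ℝ, 0 ≤ B ∧ ∀ᶠ n : ℕ in atTop, ∀ (k : I → I → ℝ) (lamhat : Fin n → ℝ)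
      (phihat : Fin n → I → ℝ), MemLp (Function.uncurry k) 2 (volume.prod volume) →
      IsEigensystem k lamhat phihat →
      eLpNorm (fun z : I × I => k z.1 z.2 - K z.1 z.2) 2 (volume.prod volume) ≤
        ENNReal.ofReal ((n : ℝ) ^ (rateExponent β - 1 / 2)) →
      supError F (weightedNormSq lam phi b)
        (sampleNormSq (truncLevel lam (δ n)) lamhat phihat a) (weightedNormSq lam phi a) ≤
        ENNReal.ofReal (B * (n : ℝ) ^ (-rateExponent β) + (δ n / C₂) ^ (2 * α / β)) := by
  obtain ⟨B, hB, hev⟩ := eventually_sampleNormSq_bounds hKm h hβ hC₀ hC₁ hC₂ hlam_le hlam_ge hgap hc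
    hδ_ge zero_le_one
  have hpos : ∀ p, 0 < lam p := fun p => lt_of_lt_of_le (by positivity) (hlam_ge p)
  obtain ⟨V, hV, hVle⟩ := exists_weightedNormSq_le h hpos hα hab
  have hlim := tendsto_zero_of_le_rpow hβ h.nonneg hlam_le
  have hδpos := eventually_threshold_pos hc hδ_ge
  obtain ⟨m, hm⟩ := eventually_atTop.1 hab
  have hasum := summable_sq_of_eventually_le hα hb hab
  have hW : 0 ≤ ∑' p, a p ^ 2 := tsum_nonneg fun _ => sq_nonneg _
  refine ⟨B * (∑' p, a p ^ 2 + V), by positivity, ?_⟩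
  filter_upwards [hev, hδpos, eventually_le_truncLevel h.antitone hlim hpos hδ hδpos m]
    with n hn hδn hmn k lamhat phihat hk hhat hD
  refine iSup₂_le fun g hg => ?_
  obtain ⟨hgF, hg1, hgb⟩ := hg
  have hgL := hF g hgF
  have hN := hVle g hgL hg1 hgb
  obtain ⟨h1, h2⟩ := hn k lamhat phihat hk hhat hD g hgL (by simpa using hg1) a hasum
  set r := (n : ℝ) ^ (-rateExponent β) with hr
  have hr0 : 0 ≤ r := by positivity
  have hE : ENNReal.ofReal (B * r) *
      (ENNReal.ofReal (∑' p, a p ^ 2) + weightedNormSq lam phi a g) ≤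
        ENNReal.ofReal (B * (∑' p, a p ^ 2 + V) * r) := by
    calc _ ≤ ENNReal.ofReal (B * r) * (ENNReal.ofReal (∑' p, a p ^ 2) + ENNReal.ofReal V) := by
          gcongr
      _ = ENNReal.ofReal (B * (∑' p, a p ^ 2 + V) * r) := by
          rw [← ENNReal.ofReal_add hW hV, ← ENNReal.ofReal_mul (by positivity)]
          congr 1; ring
  have htail := (tsum_tail_le (phi := phi) (lam := lam) (g := g) hα
    (fun p hp => hm p (hmn.trans hp)) hgb).trans
      (ENNReal.ofReal_le_ofReal (rpow_truncLevel_le hβ hC₂ h.antitone hlim hlam_ge hδn hα))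
  rw [ENNReal.ofReal_add (by positivity) (by positivity)]
  refine max_le ?_ ?_
  · rw [tsub_le_iff_left]
    exact h1.trans (add_le_add le_rfl (hE.trans le_self_add))
  · rw [tsub_le_iff_left]
    refine h2.trans ?_
    rw [add_assoc]
    exact add_le_add le_rfl (add_le_add hE htail)

/-- The sample norm of a fixed function is eventually in any neighbourhood of its norm, uniformly
over the empirical kernels close to the covariance kernel. -/
theorem eventually_sampleNormSq_mem (hKm : Measurable (Function.uncurry K))
    (h : IsEigensystem K lam phi) (hβ : 0 < β) (hC₀ : 0 < C₀) (hC₁ : 0 < C₁) (hC₂ : 0 < C₂)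
    (hlam_le : ∀ p : ℕ, lam p ≤ C₁ * ((p : ℝ) + 1) ^ (-β))
    (hlam_ge : ∀ p : ℕ, C₂ * ((p : ℝ) + 1) ^ (-β) ≤ lam p)
    (hgap : ∀ p : ℕ, C₀ * ((p : ℝ) + 1) ^ (-(β + 1)) ≤ lam p - lam (p + 1))
    (ha : Summable fun p => a p ^ 2)
    (hδ : Tendsto δ atTop (𝓝 0)) (hc : 0 < c)
    (hδ_ge : ∀ᶠ n : ℕ in atTop,
      c * (Real.sqrt n / Real.log n) ^ (-(β / (2 * β + 1))) ≤ δ n)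
    {g : I → ℝ} (hg : MemLp g 2 volume) {s : Set ℝ≥0∞} (hs : s ∈ 𝓝 (weightedNormSq lam phi a g)) :
    ∀ᶠ n : ℕ in atTop, ∀ (k : I → I → ℝ) (lamhat : Fin n → ℝ)
      (phihat : Fin n → I → ℝ), MemLp (Function.uncurry k) 2 (volume.prod volume) →
      IsEigensystem k lamhat phihat →
      eLpNorm (fun z : I × I => k z.1 z.2 - K z.1 z.2) 2 (volume.prod volume) ≤
        ENNReal.ofReal ((n : ℝ) ^ (rateExponent β - 1 / 2)) →
      sampleNormSq (truncLevel lam (δ n)) lamhat phihat a g ∈ s := by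
  obtain ⟨B, hB, hev⟩ := eventually_sampleNormSq_bounds hKm h hβ hC₀ hC₁ hC₂ hlam_le hlam_ge hgap hc
    hδ_ge (G := (eLpNorm g 2 volume).toReal) ENNReal.toReal_nonneg
  have hpos : ∀ p, 0 < lam p := fun p => lt_of_lt_of_le (by positivity) (hlam_ge p)
  have hlim := tendsto_zero_of_le_rpow hβ h.nonneg hlam_le
  have hδpos := eventually_threshold_pos hc hδ_ge
  have hgG : eLpNorm g 2 volume ≤ ENNReal.ofReal (eLpNorm g 2 volume).toReal := by
    rw [ENNReal.ofReal_toReal hg.2.ne]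
  have hMtop : Tendsto (fun n => truncLevel lam (δ n)) atTop atTop :=
    tendsto_atTop.2 fun m => eventually_le_truncLevel h.antitone hlim hpos hδ hδpos m
  have herr : ∀ c : ℝ≥0∞, c ≠ ∞ →
      Tendsto (fun n : ℕ => ENNReal.ofReal (B * (n : ℝ) ^ (-rateExponent β)) * c) atTop (𝓝 0) := by
    intro c hc
    have := (tendsto_natCast_rpow_neg (rateExponent_pos hβ)).const_mul B
    rw [mul_zero] at this
    have := ENNReal.Tendsto.mul_const (ENNReal.tendsto_ofReal this) (Or.inr hc)
    simpa using this
  have htailterm : ∀ w : ℕ → ℝ, weightedNormSq lam phi w g ≠ ∞ →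
      Tendsto (fun n => ∑' p, ENNReal.ofReal (innerL2 g (phi (p + truncLevel lam (δ n))) ^ 2 *
          w (p + truncLevel lam (δ n)) ^ 2) /
            ENNReal.ofReal (lam (p + truncLevel lam (δ n)))) atTop (𝓝 0) := fun w hw =>
    (ENNReal.tendsto_sum_nat_add (fun p => ENNReal.ofReal (innerL2 g (phi p) ^ 2 * w p ^ 2) /
      ENNReal.ofReal (lam p)) hw).comp hMtop
  have hE : ∀ w : ℕ → ℝ, weightedNormSq lam phi w g ≠ ∞ → ∀ ε : ℝ≥0∞, 0 < ε →
      ∀ᶠ n : ℕ in atTop, ENNReal.ofReal (B * (n : ℝ) ^ (-rateExponent β)) *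
          (ENNReal.ofReal (∑' p, w p ^ 2) + weightedNormSq lam phi w g) +
        ∑' p, ENNReal.ofReal (innerL2 g (phi (p + truncLevel lam (δ n))) ^ 2 *
          w (p + truncLevel lam (δ n)) ^ 2) /
            ENNReal.ofReal (lam (p + truncLevel lam (δ n))) ≤ ε := by
    intro w hw ε hε
    have := (herr (ENNReal.ofReal (∑' p, w p ^ 2) + weightedNormSq lam phi w g)
      (ENNReal.add_ne_top.2 ⟨ENNReal.ofReal_ne_top, hw⟩)).add (htailterm w hw)
    rw [add_zero] at this
    exact this.eventually_le_const hε
  by_cases htop : weightedNormSq lam phi a g = ∞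
  · rw [htop, ENNReal.nhds_top_basis.mem_iff] at hs
    obtain ⟨R, hR, hRs⟩ := hs
    obtain ⟨m, hm⟩ : ∃ m, R + 1 < ∑ p ∈ Finset.range m,
        ENNReal.ofReal (innerL2 g (phi p) ^ 2 * a p ^ 2) / ENNReal.ofReal (lam p) := by
      have h1 := (ENNReal.summable (f := fun p =>
        ENNReal.ofReal (innerL2 g (phi p) ^ 2 * a p ^ 2) /
          ENNReal.ofReal (lam p))).hasSum.tendsto_sum_nat
      have h2 : ∑' p, ENNReal.ofReal (innerL2 g (phi p) ^ 2 * a p ^ 2) /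
          ENNReal.ofReal (lam p) = ∞ := htop
      rw [h2] at h1
      exact (h1.eventually_const_lt (ENNReal.add_lt_top.2 ⟨hR, ENNReal.one_lt_top⟩)).exists
    -- The cut-off weights have a finite norm exceeding R + 1. Their sample norm is eventually
    -- within 1 of it from below, and is dominated by the sample norm with the weights `a`.
    set w : ℕ → ℝ := fun p => if p < m then a p else 0 with hw
    have hwm : ∀ p, w p ^ 2 ≤ a p ^ 2 := by
      intro p
      simp only [hw]
      split_ifs
      · exact le_rfl
      · simpa using sq_nonneg (a p)
    have hwsum : Summable fun p => w p ^ 2 := ha.of_nonneg_of_le (fun _ => sq_nonneg _) hwm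
    have hwN : weightedNormSq lam phi w g = ∑ p ∈ Finset.range m,
        ENNReal.ofReal (innerL2 g (phi p) ^ 2 * a p ^ 2) / ENNReal.ofReal (lam p) := by
      rw [weightedNormSq, tsum_eq_sum (s := Finset.range m)]
      · refine Finset.sum_congr rfl fun p hp => ?_
        rw [hw]; simp only [if_pos (Finset.mem_range.1 hp)]
      · intro p hp
        rw [Finset.mem_range] at hp
        simp [hw, hp]
    have hwtop : weightedNormSq lam phi w g ≠ ∞ := by
      rw [hwN]
      refine ENNReal.sum_ne_top.2 fun p _ => ENNReal.div_ne_top ENNReal.ofReal_ne_top ?_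
      simpa using hpos p
    filter_upwards [hev, hE w hwtop 1 zero_lt_one] with n hn hn1 k lamhat phihat hk hhat hD
    apply hRs
    have h2 := (hn k lamhat phihat hk hhat hD g hg hgG w hwsum).2
    rw [add_assoc] at h2
    have h3 : sampleNormSq (truncLevel lam (δ n)) lamhat phihat w g ≤
        sampleNormSq (truncLevel lam (δ n)) lamhat phihat a g := by
      unfold sampleNormSq
      refine weightedNormSq_mono (fun p => ?_) g
      exact hwm _
    have h4 : R + 1 < sampleNormSq (truncLevel lam (δ n)) lamhat phihat a g + 1 := by
      rw [← hwN] at hm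
      exact hm.trans_le (h2.trans (add_le_add h3 hn1))
    exact lt_of_add_lt_add_right h4
  · obtain ⟨ε, hε, hεs⟩ := (ENNReal.hasBasis_nhds_of_ne_top htop).mem_iff.1 hs
    filter_upwards [hev, hE a htop ε hε] with n hn hn1 k lamhat phihat hk hhat hD
    apply hεs
    obtain ⟨h1, h2⟩ := hn k lamhat phihat hk hhat hD g hg hgG a ha
    rw [add_assoc] at h2
    constructor
    · rw [tsub_le_iff_right]
      exact h2.trans (add_le_add le_rfl hn1)
    · exact h1.trans (add_le_add le_rfl (le_self_add.trans hn1))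

end Deterministic

/-! ### Measurability of the norm and continuity of the depth. -/

section Depth

variable {Ω : Type*} [MeasurableSpace Ω] {P : Measure Ω}

theorem measurable_innerL2 {f : Ω → I → ℝ} (hf : Measurable (Function.uncurry f)) {u : I → ℝ}
    (hu : MemLp u 2 volume) : Measurable fun ω => innerL2 (f ω) u := by
  -- `u` is only almost everywhere measurable, so it is replaced by a measurable version before
  -- joint measurability is used.
  have e : ∀ ω, innerL2 (f ω) u = ∫ t, f ω t * hu.1.mk u t := by
    intro ω
    refine integral_congr_ae ?_
    filter_upwards [hu.1.ae_eq_mk] with t ht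
    rw [ht]
  simp only [e]
  have hm : Measurable fun y : Ω × I => f y.1 y.2 * hu.1.mk u y.2 :=
    hf.mul (hu.1.stronglyMeasurable_mk.measurable.comp measurable_snd)
  exact hm.stronglyMeasurable.integral_prod_right'.measurable

theorem measurable_weightedNormSq {f : Ω → I → ℝ} (hf : Measurable (Function.uncurry f))
    {phi : ℕ → I → ℝ} (hphi : ∀ p, MemLp (phi p) 2 volume) (lam w : ℕ → ℝ) :
    Measurable fun ω => weightedNormSq lam phi w (f ω) :=
  Measurable.tsum fun p =>
    ((((measurable_innerL2 hf (hphi p)).pow_const 2).mul_const _).ennreal_ofReal).div_const _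

/-- Off the null set N(f) = r, the indicator of r' ≤ N(f) is constant for r' near r. The argument
also covers r = ∞. -/
theorem tendsto_upperTail [IsFiniteMeasure P] {f : Ω → I → ℝ} {N : (I → ℝ) → ℝ≥0∞}
    (hN : Measurable fun ω => N (f ω)) {r : ℝ≥0∞} (hr : P {ω | N (f ω) = r} = 0) :
    Tendsto (upperTail P f N) (𝓝 r) (𝓝 (upperTail P f N r)) := by
  have h : Tendsto (fun r' => P {ω | r' ≤ N (f ω)}) (𝓝 r) (𝓝 (P {ω | r ≤ N (f ω)})) := by
    refine tendsto_measure_of_ae_tendsto_indicator_of_isFiniteMeasure (𝓝 r)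
      (measurableSet_le measurable_const hN) (fun r' => measurableSet_le measurable_const hN) ?_
    have hae : ∀ᵐ ω ∂P, N (f ω) ≠ r := by simpa [ae_iff] using hr
    filter_upwards [hae] with ω hω
    rcases lt_or_gt_of_ne hω with hlt | hgt
    · filter_upwards [lt_mem_nhds hlt] with r' hr'
      exact ⟨fun h => absurd hr' (not_lt.2 h), fun h => absurd hlt (not_lt.2 h)⟩
    · filter_upwards [gt_mem_nhds hgt] with r' hr'
      exact ⟨fun _ => hgt.le, fun _ => hr'.le⟩
  exact (ENNReal.tendsto_toReal (measure_ne_top P _)).comp h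

theorem tendsto_measure_of_eventually_subset {s t : ℕ → Set Ω}
    (ht : Tendsto (fun n => P (t n)) atTop (𝓝 0)) (h : ∀ᶠ n in atTop, s n ⊆ t n) :
    Tendsto (fun n => P (s n)) atTop (𝓝 0) :=
  tendsto_of_tendsto_of_tendsto_of_le_of_le' tendsto_const_nhds ht
    (Eventually.of_forall fun _ => zero_le) (h.mono fun _ hn => measure_mono hn)

end Depth

/-! ### The main theorem. -/

theorem theorem1 {Ω : Type*} [MeasurableSpace Ω] (P : Measure Ω) [IsProbabilityMeasure P]
    -- the function space and the i.i.d. sample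
    (F : Set (I → ℝ)) (hF : ∀ f ∈ F, MemLp f 2 volume)
    (X : ℕ → Ω → I → ℝ) (hX : IsIIDSecondOrder P F X)
    (hX4 : ∫⁻ ω, eLpNorm (X 0 ω) 2 volume ^ 4 ∂P < ∞)
    -- eigensystems of the covariance kernel and of the empirical covariance kernels
    (lam : ℕ → ℝ) (phi : ℕ → I → ℝ) (hK : IsEigensystem (covKernel P (X 0)) lam phi)
    (lamhat : (n : ℕ) → Ω → Fin n → ℝ) (phihat : (n : ℕ) → Ω → Fin n → I → ℝ)
    (hKhat : ∀ n ω,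
      IsEigensystem (empKernel (fun i => X i ω) n) (lamhat n ω) (phihat n ω))
    -- decay of the eigenvalues and of their gaps
    (β C₀ C₁ C₂ : ℝ) (hβ : 1 < β) (hC₀ : 0 < C₀) (hC₁ : 0 < C₁) (hC₂ : 0 < C₂)
    (hlam_le : ∀ p : ℕ, lam p ≤ C₁ * ((p : ℝ) + 1) ^ (-β))
    (hlam_ge : ∀ p : ℕ, C₂ * ((p : ℝ) + 1) ^ (-β) ≤ lam p)
    (hgap : ∀ p : ℕ, C₀ * ((p : ℝ) + 1) ^ (-(β + 1)) ≤ lam p - lam (p + 1))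
    -- the weights
    (a b : ℕ → ℝ) (α : ℝ) (hα : 0 < α) (hb : Summable fun p => b p ^ 2)
    (hab : ∀ᶠ p : ℕ in atTop, |a p| ≤ b p * ((p : ℝ) + 1) ^ (-α))
    -- the thresholds
    (δ : ℕ → ℝ) (hδ : Tendsto δ atTop (𝓝 0)) (c : ℝ) (hc : 0 < c)
    (hδ_ge : ∀ᶠ n : ℕ in atTop,
      c * (Real.sqrt n / Real.log n) ^ (-(β / (2 * β + 1))) ≤ δ n) :
    -- polynomial rate, uniformly over the unit balls, with probability tending to one
    ((∃ η : ℝ, 0 < η ∧ δ =O[atTop] fun n : ℕ => (n : ℝ) ^ (-η)) →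
      ∃ C κ : ℝ, 0 < C ∧ 0 < κ ∧
        Tendsto (fun n : ℕ => P {ω | ¬ supError F (weightedNormSq lam phi b)
            (sampleNormSq (truncLevel lam (δ n)) (lamhat n ω) (phihat n ω) a)
            (weightedNormSq lam phi a) ≤ ENNReal.ofReal (C * (n : ℝ) ^ (-κ))})
          atTop (𝓝 0)) ∧
    -- uniform convergence in probability, at whatever rate the thresholds tend to zero
    (∀ ε : ℝ, 0 < ε →
        Tendsto (fun n : ℕ => P {ω | ¬ supError F (weightedNormSq lam phi b)
            (sampleNormSq (truncLevel lam (δ n)) (lamhat n ω) (phihat n ω) a)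
            (weightedNormSq lam phi a) ≤ ENNReal.ofReal ε})
          atTop (𝓝 0)) ∧
    -- convergence in probability of the depth
    (∀ fobs ∈ F, P {ω | weightedNormSq lam phi a (X 0 ω) = weightedNormSq lam phi a fobs} = 0 →
      TendstoInMeasure P
        (fun n ω => upperTail P (X 0) (weightedNormSq lam phi a)
          (sampleNormSq (truncLevel lam (δ n)) (lamhat n ω) (phihat n ω) a fobs))
        atTop
        (fun _ => upperTail P (X 0) (weightedNormSq lam phi a)
          (weightedNormSq lam phi a fobs))) := by
  have hβ0 : 0 < β := by linarith
  have hKm := measurable_uncurry_covKernel (P := P) (hX.measurable 0)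
  have hgood := tendsto_measure_empKernel hX hX4 (rateExponent_pos hβ0) (rateExponent_le_half hβ0)
  obtain ⟨B, hB, hsup⟩ := eventually_supError_le hF hKm hK hβ0 hC₀ hC₁ hC₂ hlam_le hlam_ge hgap hα
    hb hab hδ hc hδ_ge
  have hδpos := eventually_threshold_pos hc hδ_ge
  have hθ : 0 < 2 * α / β := by positivity
  have hbound : ∀ R : ℕ → ℝ, (∀ᶠ n : ℕ in atTop,
      B * (n : ℝ) ^ (-rateExponent β) + (δ n / C₂) ^ (2 * α / β) ≤ R n) →
      Tendsto (fun n : ℕ => P {ω | ¬ supError F (weightedNormSq lam phi b)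
        (sampleNormSq (truncLevel lam (δ n)) (lamhat n ω) (phihat n ω) a)
        (weightedNormSq lam phi a) ≤ ENNReal.ofReal (R n)}) atTop (𝓝 0) := by
    intro R hR
    -- Monotonicity of the outer measure suffices: the exceptional set, a supremum over `F` with
    -- arbitrary eigenfunctions, need not be measurable.
    refine tendsto_measure_of_eventually_subset hgood ?_
    filter_upwards [hsup, hR] with n hn hRn ω hω hcl
    exact hω ((hn _ _ _ (memLp_empKernel hX hF n ω) (hKhat n ω) hcl).trans
      (ENNReal.ofReal_le_ofReal hRn))
  refine ⟨?_, ?_, ?_⟩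
  · rintro ⟨η, hη, hO⟩
    obtain ⟨C₃, hC₃, hO⟩ := hO.exists_pos
    -- The head decays with exponent κ and the tail with exponent η · 2α/β; the slower one is the
    -- rate.
    refine ⟨B + (C₃ / C₂) ^ (2 * α / β), min (rateExponent β) (η * (2 * α / β)), by positivity,
      lt_min (rateExponent_pos hβ0) (by positivity), hbound _ ?_⟩
    filter_upwards [hO.bound, hδpos, eventually_gt_atTop 0] with n hn hδn hn0
    have hn1 : (1 : ℝ) ≤ n := by exact_mod_cast hn0
    have hn0' : (0 : ℝ) ≤ n := n.cast_nonneg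
    rw [Real.norm_of_nonneg hδn.le, Real.norm_of_nonneg (by positivity)] at hn
    rw [add_mul]
    refine add_le_add ?_ ?_
    · gcongr
      exact min_le_left _ _
    · calc (δ n / C₂) ^ (2 * α / β) ≤ (C₃ * (n : ℝ) ^ (-η) / C₂) ^ (2 * α / β) := by gcongr
        _ = (C₃ / C₂ * (n : ℝ) ^ (-η)) ^ (2 * α / β) := by congr 1; ring
        _ = (C₃ / C₂) ^ (2 * α / β) * (n : ℝ) ^ (-(η * (2 * α / β))) := by
          rw [Real.mul_rpow (by positivity) (by positivity), ← Real.rpow_mul hn0', neg_mul]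
        _ ≤ _ := by
          gcongr
          exact min_le_right _ _
  · intro ε hε
    refine hbound (fun _ => ε) ?_
    have h1 := (tendsto_natCast_rpow_neg (rateExponent_pos hβ0)).const_mul B
    have h2 := (hδ.div_const C₂).rpow_const (p := 2 * α / β) (Or.inr hθ.le)
    have h3 := h1.add h2
    rw [mul_zero, zero_div, Real.zero_rpow hθ.ne', add_zero] at h3
    exact h3.eventually_le_const hε
  · intro fobs hfobs hcont ε hε
    have ha := summable_sq_of_eventually_le hα hb hab
    have htail := tendsto_upperTail (measurable_weightedNormSq (hX.measurable 0) hK.memLp lam a) hcont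
    refine tendsto_measure_of_eventually_subset hgood ?_
    filter_upwards [eventually_sampleNormSq_mem hKm hK hβ0 hC₀ hC₁ hC₂ hlam_le hlam_ge hgap ha hδ hc
      hδ_ge (hF fobs hfobs) (htail (Metric.eball_mem_nhds _ hε))] with n hn ω hω hcl
    have hmem := hn _ _ _ (memLp_empKernel hX hF n ω) (hKhat n ω) hcl
    exact absurd (Metric.mem_eball.1 hmem) (not_lt.2 hω)
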